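/- Let $K$ be a number field, $X$ a smooth, absolutely irreducible, projective curve over $K$, $\eta\in X(K)$, $Y=X\setminus\{\eta\}$, $F=K(X)$, and let $A\subset F$ be the ring of rational functions on $X$ that are regular on $Y$; for $0\ne g\in F$ put $\deg(g)=-\operatorname{ord}_\eta(g)$. Let $P,Q\in A[x]$ be such that the resultant $\operatorname{Res}(P,Q)$ and the leading coefficients of $P$ and of $Q$ are nonzero constants (elements of $K^*$), let $\mathbf f=P/Q\in F(x)$ be of degree $d=\max(\deg_xP,\deg_xQ)\ge 2$, and suppose that $\infty$ is a superattracting periodic point of $\mathbf f$, i.e. for some $n\ge1$ the iterate $\mathbf f^n$ fixes $\infty$ and has derivative $0$ there (in the coordinate $1/x$). Let $\mathbf c=[\mathbf a:\mathbf b]\in\mathbb P^1(F)$, where $\mathbf a,\mathbf b\in A$ generate the unit ideal of $A$, and suppose that the degrees $\deg(\mathbf f^n(\mathbf c))$, over the $n\ge0$ with $\mathbf f^n(\mathbf c)\neq 0,\infty$, are not bounded above. For $\lambda\in Y(\bar K)$ let $\mathbf f_\lambda=P_\lambda/Q_\lambda$ be obtained by evaluating the coefficients of $P$ and $Q$ at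 $\lambda$, and let $\mathbf c(\lambda)=[\mathbf a(\lambda):\mathbf b(\lambda)]$. Then the canonical heights $$\hat h_{\mathbf f}(\mathbf c)=\lim_{n\to\infty}\frac{h_F(\mathbf f^n(\mathbf c))}{d^n},\qquad \hat h_{\mathbf f_\lambda}(\mathbf c(\lambda))=\lim_{n\to\infty}\frac{h_{\bar K}(\mathbf f_\lambda^n(\mathbf c(\lambda)))}{d^n}\quad(\lambda\in Y(\bar K))$$ exist, where $h_{\bar K}$ is the absolute logarithmic Weil height on $\mathbb P^1(\bar K)$ and $h_F([x_0:x_1])=\sum_{p}[K(p):K]\max_i(-\operatorname{ord}_p x_i)$, the sum being over the closed points $p$ of $X$, with residue fields $K(p)$. Moreover, for every Weil height $h$ on $X(\bar K)$ associated to the divisor class of $\eta$, $$\hat h_{\mathbf f_\lambda}(\mathbf c(\lambda))=\hat h_{\mathbf f}(\mathbf c)\,h(\lambda)+O(1)\qquad\text{for all }\lambda\in Y(\bar K),$$ where the implied constant does not depend on $\lambda$. -/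

import Mathlib

open Polynomial Filter Topology
open scoped WithZero

noncomputable section

/-! ### Curves over a number field, through their function fields

A smooth, absolutely irreducible, projective curve `X` over a field `K` of characteristic zero is
given by its function field `F = K(X)`.  Its closed points are the places of `F / K`,
i.e. the discrete valuation rings of `F / K` (the local rings of the closed points of `X`). -/

/-- `F` is the function field of a smooth, absolutely irreducible, projective curve over `K`
(for `K` of characteristic zero): it is a finitely generated field extension of transcendence
degree one in which `K` is algebraically closed. -/
structure IsCurveFunctionField (K F : Type*) [Field K] [Field F] [Algebra K F] : Prop where
  fg : (⊤ : IntermediateField K F).FG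
  trdeg_eq_one : Algebra.trdeg K F = 1
  algClosed : algebraicClosure K F = ⊥

/-- A closed point of the curve with function field `F / K`, given by its local ring:
a discrete valuation ring containing `K` with fraction field `F`. -/
@[ext]
structure Place (K F : Type*) [Field K] [Field F] [Algebra K F] where
  ring : Subalgebra K F
  isDVR : IsDiscreteValuationRing ring
  isFractionRing : IsFractionRing ring F

namespace Place

variable {K F : Type*} [Field K] [Field F] [Algebra K F]

instance (p : Place K F) : IsDiscreteValuationRing p.ring := p.isDVR

instance (p : Place K F) : IsFractionRing p.ring F := p.isFractionRing

/-- The valuation of `F` at the closed point `p`, normalised so that a uniformizer has value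
`exp (-1)`; that is, `p.val x = exp (- ord_p x)` for `x ≠ 0`, and `p.val 0 = 0`. -/
def val (p : Place K F) : Valuation F ℤᵐ⁰ :=
  (IsDiscreteValuationRing.maximalIdeal p.ring).valuation F

/-- The degree over `K` of the residue field of the closed point `p`. -/
def degree (p : Place K F) : ℕ := Module.finrank K (IsLocalRing.ResidueField p.ring)

/-- The ring of functions that are regular away from `η`. -/
def regularRing (η : Place K F) : Subalgebra K F :=
  ⨅ (p : Place K F) (_ : p ≠ η), p.ring

theorem regularRing_le {η p : Place K F} (h : p ≠ η) : η.regularRing ≤ p.ring :=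
  iInf₂_le p h

/-- The degree function `deg = - ord_η` on nonzero functions (the value at `0` is `0`). -/
def deg (η : Place K F) (x : F) : ℤ := WithZero.log (η.val x)

/-- A geometric point of `Y = X ∖ {η}`, with values in an algebraic closure of `K`: a closed
point `p ≠ η` and a `K`-algebra homomorphism from its local ring to the algebraic closure
(it kills the maximal ideal, so it is an embedding of the residue field). -/
structure AffinePoint (η : Place K F) where
  place : Place K F
  ne : place ≠ η
  hom : place.ring →ₐ[K] AlgebraicClosure K

/-- Evaluation at a geometric point of `Y` of the functions regular on `Y`. -/
def AffinePoint.eval {η : Place K F} (l : AffinePoint η) :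
    η.regularRing →ₐ[K] AlgebraicClosure K :=
  l.hom.comp (Subalgebra.inclusion (regularRing_le l.ne))

end Place

/-! ### Heights -/

section Heights

variable {K F : Type*} [Field K] [Field F] [Algebra K F]

/-- The Weil height of the point with homogeneous coordinates `x` over the function field `F`:
the sum over all closed points `p` of `deg p * max_i (- ord_p (x i))`. -/
def functionFieldHeight (K : Type*) {F : Type*} [Field K] [Field F] [Algebra K F]
    {ι : Type*} [Fintype ι] (x : ι → F) : ℝ :=
  ∑ᶠ p : Place K F,
    (p.degree : ℝ) * ((WithZero.log (Finset.univ.sup fun i => p.val (x i)) : ℤ) : ℝ)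

theorem numberField_adjoin_range [NumberField K] {ι : Type*} [Finite ι]
    (x : ι → AlgebraicClosure K) :
    NumberField (IntermediateField.adjoin K (Set.range x)) := by
  have : FiniteDimensional K (IntermediateField.adjoin K (Set.range x)) :=
    IntermediateField.finiteDimensional_adjoin fun y _ =>
      Algebra.IsIntegral.isIntegral y
  exact NumberField.of_module_finite K _

/-- The absolute logarithmic Weil height of the point with homogeneous coordinates `x` over the
algebraic closure of the number field `K`. It is computed in the number field `K(x)` and divided
by the degree of that field over `ℚ`. -/
def absLogHeight [NumberField K] {ι : Type*} [Finite ι] (x : ι → AlgebraicClosure K) : ℝ :=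
  haveI : NumberField (IntermediateField.adjoin K (Set.range x)) := numberField_adjoin_range x
  Height.logHeight (fun i =>
      (⟨x i, IntermediateField.subset_adjoin K _ ⟨i, rfl⟩⟩ :
        IntermediateField.adjoin K (Set.range x))) /
    (Module.finrank ℚ (IntermediateField.adjoin K (Set.range x)) : ℝ)

/-- The finite family `s` of functions regular away from `η` consists of global sections of the
line bundle `𝓞(m η)` that generate it: `max_i (- ord_p (s i))` is `0` at every closed point
`p ≠ η` and is `m` at `η`. -/
def GeneratesMultiple (η : Place K F) (m : ℕ) {ι : Type*} [Fintype ι]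
    (s : ι → η.regularRing) : Prop :=
  (∀ p : Place K F, p ≠ η → (Finset.univ.sup fun i => p.val (s i : F)) = 1) ∧
    (Finset.univ.sup fun i => η.val (s i : F)) = WithZero.exp (m : ℤ)

/-- `h` is (the restriction to `Y = X ∖ {η}` of) a Weil height for the divisor class of `η`:
for some `m ≥ 1` and some morphism `s` from `X` to a projective space given by generating sections
of `𝓞(m η)`, the function `h` differs from `(1 / m) * (height of s)` by a bounded function. -/
def IsWeilHeight [NumberField K] (η : Place K F) (h : η.AffinePoint → ℝ) : Prop :=
  ∃ (m r : ℕ) (s : Fin r → η.regularRing), 1 ≤ m ∧ GeneratesMultiple η m s ∧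
    ∃ C : ℝ, ∀ l : η.AffinePoint, |h l - absLogHeight (fun i => l.eval (s i)) / m| ≤ C

end Heights

/-! ### Rational maps of the projective line -/

/-- The degree of the rational map `p / q` (for coprime `p` and `q`). -/
def ratDegree {R : Type*} [CommRing R] (p q : R[X]) : ℕ := max p.natDegree q.natDegree

/-- The rational map `p / q` in homogeneous coordinates:
`[x : y] ↦ [y ^ d * p (x / y) : y ^ d * q (x / y)]` with `d` the degree of `p / q`. -/
def ratLift {R S : Type*} [CommRing R] [CommRing S] [Algebra R S] (p q : R[X])
    (x : Fin 2 → S) : Fin 2 → S :=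
  ![MvPolynomial.aeval x (p.homogenize (ratDegree p q)),
    MvPolynomial.aeval x (q.homogenize (ratDegree p q))]

/-- The point at infinity is a superattracting periodic point of `f = p / q`: for some `n ≥ 1`, the
`n`-th iterate, which in the coordinate `w = 1 / x` is `w ↦ v 1 / v 0`, fixes the point
`w = 0` and has derivative zero there. -/
def SuperattractingAtInfinity {k : Type*} [Field k] (p q : k[X]) : Prop :=
  ∃ n : ℕ, 1 ≤ n ∧
    let v : Fin 2 → k[X] := (ratLift p q)^[n] ![1, X]
    (v 0).eval 0 ≠ 0 ∧ (v 1).eval 0 = 0 ∧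
      (derivative (v 1) * v 0 - v 1 * derivative (v 0)).eval 0 = 0

/-- `H` is the canonical height of the point `x` for the rational map `p / q`, with respect to
the Weil height `ht`: the limit of `ht (f^n (x)) / d ^ n` exists and equals `H`. -/
def HasCanonicalHeight {k : Type*} [Field k] (ht : (Fin 2 → k) → ℝ) (p q : k[X])
    (x : Fin 2 → k) (H : ℝ) : Prop :=
  Tendsto (fun n : ℕ => ht ((ratLift p q)^[n] x) / (ratDegree p q : ℝ) ^ n) atTop (𝓝 H)

/-- `x` is a nonzero constant, i.e. it lies in the image of `Kˣ`. -/
def IsNonzeroConstant (K : Type*) {R : Type*} [Field K] [CommRing R] [Algebra K R] (x : R) :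
    Prop :=
  ∃ t : K, t ≠ 0 ∧ x = algebraMap K R t

end

/-! ### Heights and field extensions -/

namespace NumberField

open Height Module

variable {L M : Type*} [Field L] [NumberField L] [Field M] [NumberField M] [Algebra L M]

/-! Everything is reduced to one local estimate, uniform over all nonnegative multiplicative
functions φ on A with φ(x + y) ≤ C·max(φ x, φ y) (`QuasiAbs`). Among these are |ev_λ(·)|_v, for λ in
Y and v a place of the residue field of λ, and also the absolute value at η itself. Errors are
measured by `bd κ φ`, the product of C·max(1, φ(c)) over a finite multiset κ of constants. For κ in
K, the sum of log `bd κ` over the places of the residue field, divided by its degree over ℚ, is a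
sum of terms log 2 + h(c), independent of λ (`sum_log_bd`); at η, log `bd κ` is 0. Hence one
inequality with error log `bd κ φ` yields both an O(1) uniform in λ and an exact equality at η.

The estimate (`log_nm_iterate_sub_le`) says that log‖f^N(c)‖/d^N, for N = nj + n₀, differs from
(D₀/d^n₀)·log size(φ) by at most log `bd κ φ`, uniformly in j. Here size(φ) = (max φ(s_i))^(1/m) for
generating sections s_i of 𝓞(mη). At η the logarithm of the size is 1, so the canonical height of c
is D₀/d^n₀; summing over the places v gives the theorem.

Two regions are treated separately. Where the size is bounded by constants of K, every element of A
is so bounded too, and Tate's telescoping bounds both terms. Where the size is large, φ is close to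
η and the orbit lies in the basin of the superattracting cycle from time n₀ on: the first coordinate
dominates, and the n-th iterate multiplies its logarithm by d^n up to a bounded error, because the
leading term is a unit of A and therefore a constant. The time n₀ exists because the degrees along
the orbit are unbounded.

Elements of A are compared by `adm_le`: an inequality between pole orders at all places gives an
inequality under every φ, by way of an integral equation with coefficients in K. This rests on
valuation rings of F containing K, other than F, being places. -/

theorem prod_infinitePlace_eq_prod_embeddings {ι : Type*} (x : ι → L) :
    ∏ w : InfinitePlace L, (⨆ i, w (x i)) ^ w.mult = ∏ φ : L →+* ℂ, ⨆ i, ‖φ (x i)‖ := by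
  classical
  rw [← Finset.prod_fiberwise Finset.univ InfinitePlace.mk (fun φ : L →+* ℂ => ⨆ i, ‖φ (x i)‖)]
  refine Finset.prod_congr rfl fun w _ => ?_
  rw [← InfinitePlace.card_filter_mk_eq w, ← Finset.prod_const]
  refine Finset.prod_congr rfl fun φ hφ => ?_
  rw [← (Finset.mem_filter.mp hφ).2]
  rfl

/-- The extensions of τ to M are the L-algebra maps M → ℂ once ℂ is an L-algebra through τ, and
there are [M : L] of these. -/
theorem card_embeddings_over (τ : L →+* ℂ) [DecidableEq (L →+* ℂ)] :
    (Finset.univ.filter fun σ : M →+* ℂ => σ.comp (algebraMap L M) = τ).card = finrank L M := by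
  let : Algebra L ℂ := τ.toAlgebra
  have : FiniteDimensional L M := Module.Finite.of_restrictScalars_finite ℚ L M
  rw [← AlgHom.card L M ℂ, ← Fintype.card_coe]
  refine Fintype.card_congr
    { toFun := fun σ =>
        { σ.1 with commutes' := fun r => RingHom.congr_fun (Finset.mem_filter.mp σ.2).2 r }
      invFun := fun σ => ⟨σ.toRingHom, Finset.mem_filter.mpr ⟨Finset.mem_univ _, ?_⟩⟩
      left_inv := fun σ => rfl
      right_inv := fun σ => rfl }
  ext r
  exact σ.commutes r

theorem prod_infinitePlace_extension {ι : Type*} (x : ι → L) :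
    ∏ w : InfinitePlace M, (⨆ i, w (algebraMap L M (x i))) ^ w.mult =
      (∏ w : InfinitePlace L, (⨆ i, w (x i)) ^ w.mult) ^ finrank L M := by
  classical
  rw [prod_infinitePlace_eq_prod_embeddings, prod_infinitePlace_eq_prod_embeddings,
    ← Finset.prod_fiberwise Finset.univ (fun σ : M →+* ℂ => σ.comp (algebraMap L M)),
    ← Finset.prod_pow]
  refine Finset.prod_congr rfl fun τ _ => ?_
  rw [← card_embeddings_over (M := M) τ, ← Finset.prod_const]
  refine Finset.prod_congr rfl fun σ hσ => ?_
  rw [← (Finset.mem_filter.mp hσ).2]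
  rfl

/-- For integral coordinates the finite part of the height is the inverse norm of the ideal they
generate, and extension of ideals to 𝓞 M raises norms to the power [M : L]. The archimedean part is
a product over embeddings. -/
theorem mulHeight_integral_extension {ι : Type*} [Finite ι] {x : ι → 𝓞 L} (hx : x ≠ 0) :
    mulHeight (fun i => algebraMap L M (x i)) =
      mulHeight (fun i => (x i : L)) ^ finrank L M := by
  have : FiniteDimensional L M := Module.Finite.of_restrictScalars_finite ℚ L M
  obtain ⟨i, hi⟩ := Function.ne_iff.mp hx
  have hL : (fun i => (x i : L)) ≠ 0 := Function.ne_iff.mpr ⟨i, by simpa using hi⟩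
  have hM : (fun i => algebraMap L M (x i)) ≠ 0 := Function.ne_iff.mpr ⟨i, by simpa using hi⟩
  let y : ι → 𝓞 M := fun i => algebraMap (𝓞 L) (𝓞 M) (x i)
  have hyx : ∀ i, ((y i : 𝓞 M) : M) = algebraMap L M (x i) := fun i => rfl
  have hy : y ≠ 0 := Function.ne_iff.mpr
    ⟨i, fun h => hi (RingOfIntegers.algebraMap.injective L M (by simpa [y] using h))⟩
  rw [NumberField.mulHeight_eq hL, NumberField.mulHeight_eq hM, mul_pow,
    prod_infinitePlace_extension]
  congr 1
  have e1 := absNorm_mul_finprod_finitePlace_eq_one hx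
  have e2 := absNorm_mul_finprod_finitePlace_eq_one hy
  have e3 : (Ideal.span (Set.range y)).absNorm =
      (Ideal.span (Set.range x)).absNorm ^ finrank L M := by
    have : Ideal.span (Set.range y) =
        (Ideal.span (Set.range x)).map (algebraMap (𝓞 L) (𝓞 M)) := by
      rw [Ideal.map_span, ← Set.range_comp]; rfl
    rw [this, Ideal.absNorm_algebraMap]
    congr 1
    exact (IsFractionRing.finrank_eq (𝓞 L) L (𝓞 M) M).symm
  rw [e3] at e2
  push_cast at e2
  simp only [hyx] at e2
  have e4 := congrArg (· ^ finrank L M) e1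
  simp only [mul_pow, one_pow] at e4
  exact mul_left_cancel₀ (left_ne_zero_of_mul_eq_one e4) (e2.trans e4.symm)

theorem mulHeight_extension {ι : Type*} [Finite ι] (x : ι → L) :
    mulHeight (fun i => algebraMap L M (x i)) = mulHeight x ^ finrank L M := by
  by_cases hx : x = 0
  · subst hx
    have : (fun i : ι => algebraMap L M ((0 : ι → L) i)) = 0 := by ext; simp
    rw [this]; simp
  obtain ⟨b, hb⟩ := IsLocalization.exist_integer_multiples_of_finite (nonZeroDivisors (𝓞 L)) x
  choose y hy using hb
  have hb0 : ((b : 𝓞 L) : L) ≠ 0 := by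
    simp
  have hyx : (fun i => (y i : L)) = ((b : 𝓞 L) : L) • x := by
    ext i; simpa [Algebra.smul_def] using hy i
  have hy0 : y ≠ 0 := by
    rintro rfl
    apply hx
    have : ((b : 𝓞 L) : L) • x = 0 := by rw [← hyx]; ext; simp
    exact (smul_eq_zero.mp this).resolve_left hb0
  have h1 := mulHeight_integral_extension (M := M) hy0
  rw [hyx, mulHeight_smul_eq_mulHeight x hb0] at h1
  rw [← h1]
  have : (fun i => algebraMap L M (y i)) =
      (algebraMap L M (b : 𝓞 L)) • fun i => algebraMap L M (x i) := by
    ext i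
    simp only [Pi.smul_apply, smul_eq_mul, ← map_mul]
    congr 1
    exact congrFun hyx i
  rw [this, mulHeight_smul_eq_mulHeight _ (by simp)]

theorem logHeight_extension {ι : Type*} [Finite ι] (x : ι → L) :
    logHeight (fun i => algebraMap L M (x i)) = finrank L M * logHeight x := by
  rw [logHeight_eq_log_mulHeight, mulHeight_extension, Real.log_pow,
    logHeight_eq_log_mulHeight]

theorem logHeight_extension_div_finrank {ι : Type*} [Finite ι] (x : ι → L) :
    logHeight (fun i => algebraMap L M (x i)) / finrank ℚ M = logHeight x / finrank ℚ L := by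
  have : FiniteDimensional L M := Module.Finite.of_restrictScalars_finite ℚ L M
  have h3 : (finrank ℚ M : ℝ) = finrank ℚ L * finrank L M := by
    rw [← Nat.cast_mul, finrank_mul_finrank]
  have h4 : (finrank L M : ℝ) ≠ 0 := by exact_mod_cast (finrank_pos (R := L) (M := M)).ne'
  rw [logHeight_extension, h3, mul_comm (finrank ℚ L : ℝ), mul_div_mul_left _ _ h4]

end NumberField

section AbsoluteHeight

open Height Module

variable {K : Type*} [Field K] [NumberField K] {ι : Type*} [Finite ι]

/-- The absolute logarithmic height may be computed in any number field containing the
coordinates. -/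
theorem absLogHeight_eq (L : IntermediateField K (AlgebraicClosure K)) [NumberField L]
    (x : ι → L) :
    absLogHeight (fun i => (x i : AlgebraicClosure K)) = logHeight x / finrank ℚ L := by
  unfold absLogHeight
  set E := IntermediateField.adjoin K (Set.range fun i => (x i : AlgebraicClosure K)) with hE
  have : NumberField E := numberField_adjoin_range _
  have hle : E ≤ L := IntermediateField.adjoin_le_iff.mpr (by rintro _ ⟨i, rfl⟩; exact (x i).2)
  let : Algebra E L := (IntermediateField.inclusion hle).toAlgebra
  exact (NumberField.logHeight_extension_div_finrank (L := E) (M := L)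
    (fun i => ⟨x i, IntermediateField.subset_adjoin K _ ⟨i, rfl⟩⟩)).symm

end AbsoluteHeight

/-! ### Multiplicative functions with a weak triangle inequality -/

/-- A nonnegative real valued multiplicative function on a ring with
`φ (x + y) ≤ C * max (φ x) (φ y)`. -/
structure QuasiAbs (R : Type*) [CommRing R] where
  toFun : R → ℝ
  C : ℝ
  one_le_C : 1 ≤ C
  nonneg' : ∀ x, 0 ≤ toFun x
  map_zero' : toFun 0 = 0
  map_one' : toFun 1 = 1
  map_mul' : ∀ x y, toFun (x * y) = toFun x * toFun y
  add_le' : ∀ x y, toFun (x + y) ≤ C * max (toFun x) (toFun y)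

namespace QuasiAbs

variable {R S k : Type*} [CommRing R] [CommRing S] [CommRing k] [Algebra k R]

instance : CoeFun (QuasiAbs R) fun _ => R → ℝ := ⟨toFun⟩

theorem nonneg (φ : QuasiAbs R) (x : R) : 0 ≤ φ x := φ.nonneg' x

@[simp] protected theorem map_zero (φ : QuasiAbs R) : φ 0 = 0 := φ.map_zero'

@[simp] protected theorem map_one (φ : QuasiAbs R) : φ 1 = 1 := φ.map_one'

@[simp] protected theorem map_mul (φ : QuasiAbs R) (x y : R) : φ (x * y) = φ x * φ y := φ.map_mul' x y

theorem add_le (φ : QuasiAbs R) (x y : R) : φ (x + y) ≤ φ.C * max (φ x) (φ y) := φ.add_le' x y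

@[simp] protected theorem map_pow (φ : QuasiAbs R) (x : R) (n : ℕ) : φ (x ^ n) = φ x ^ n := by
  induction n with
  | zero => simp
  | succ n ih => rw [pow_succ, pow_succ, φ.map_mul, ih]

@[simp] protected theorem map_neg (φ : QuasiAbs R) (x : R) : φ (-x) = φ x := by
  have h : φ (-1) * φ (-1) = 1 := by rw [← φ.map_mul]; simp
  have h1 : φ (-1) = 1 := by nlinarith [φ.nonneg (-1)]
  rw [← neg_one_mul, φ.map_mul, h1, one_mul]

protected theorem map_prod (φ : QuasiAbs R) {ι : Type*} (s : Finset ι) (f : ι → R) :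
    φ (∏ i ∈ s, f i) = ∏ i ∈ s, φ (f i) := by
  classical
  induction s using Finset.induction_on with
  | empty => simp
  | insert i s hi ih => rw [Finset.prod_insert hi, Finset.prod_insert hi, φ.map_mul, ih]

theorem C_nonneg (φ : QuasiAbs R) : 0 ≤ φ.C := zero_le_one.trans φ.one_le_C

theorem sum_le (φ : QuasiAbs R) {ι : Type*} (s : Finset ι) (f : ι → R) {B : ℝ} (hB : 0 ≤ B)
    (h : ∀ i ∈ s, φ (f i) ≤ B) : φ (∑ i ∈ s, f i) ≤ φ.C ^ s.card * B := by
  classical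
  induction s using Finset.induction_on with
  | empty => simpa using hB
  | insert i s hi ih =>
    rw [Finset.sum_insert hi, Finset.card_insert_of_notMem hi, pow_succ', mul_assoc]
    refine (φ.add_le _ _).trans (mul_le_mul_of_nonneg_left (max_le ?_ ?_) φ.C_nonneg)
    · refine (h i (Finset.mem_insert_self _ _)).trans ?_
      exact le_mul_of_one_le_left hB (one_le_pow₀ φ.one_le_C)
    · exact ih fun j hj => h j (Finset.mem_insert_of_mem hj)

/-- Composition with a ring homomorphism. -/
def comp (φ : QuasiAbs S) (f : R →+* S) : QuasiAbs R where
  toFun x := φ (f x)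
  C := φ.C
  one_le_C := φ.one_le_C
  nonneg' x := φ.nonneg _
  map_zero' := by simp
  map_one' := by simp
  map_mul' x y := by simp
  add_le' x y := by simpa using φ.add_le (f x) (f y)

@[simp] theorem comp_apply (φ : QuasiAbs S) (f : R →+* S) (x : R) : φ.comp f x = φ (f x) := rfl

/-! ### Bounds in terms of constants -/

/-- The bound attached to a finite family of constants. -/
noncomputable def bd (κ : Multiset k) (φ : QuasiAbs R) : ℝ :=
  (κ.map fun c => φ.C * max 1 (φ (algebraMap k R c))).prod

@[simp] theorem bd_zero (φ : QuasiAbs R) : bd (0 : Multiset k) φ = 1 := by simp [bd]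

theorem bd_add (κ κ' : Multiset k) (φ : QuasiAbs R) : bd (κ + κ') φ = bd κ φ * bd κ' φ := by
  simp [bd]

theorem bd_cons (c : k) (κ : Multiset k) (φ : QuasiAbs R) :
    bd (c ::ₘ κ) φ = φ.C * max 1 (φ (algebraMap k R c)) * bd κ φ := by simp [bd]

theorem one_le_bd (κ : Multiset k) (φ : QuasiAbs R) : 1 ≤ bd κ φ := by
  induction κ using Multiset.induction_on with
  | empty => simp
  | cons c κ ih =>
    rw [bd_cons]
    exact one_le_mul_of_one_le_of_one_le
      (one_le_mul_of_one_le_of_one_le φ.one_le_C (le_max_left _ _)) ih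

theorem bd_pos (κ : Multiset k) (φ : QuasiAbs R) : 0 < bd κ φ := zero_lt_one.trans_le (one_le_bd κ φ)

theorem bd_mono {κ κ' : Multiset k} (h : κ ≤ κ') (φ : QuasiAbs R) : bd κ φ ≤ bd κ' φ := by
  obtain ⟨κ'', rfl⟩ := Multiset.le_iff_exists_add.mp h
  rw [bd_add]
  exact le_mul_of_one_le_right (bd_pos κ φ).le (one_le_bd κ'' φ)

theorem bd_le_left (κ κ' : Multiset k) (φ : QuasiAbs R) : bd κ φ ≤ bd (κ + κ') φ :=
  bd_mono (Multiset.le_add_right _ _) φ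

theorem bd_le_right (κ κ' : Multiset k) (φ : QuasiAbs R) : bd κ' φ ≤ bd (κ + κ') φ :=
  bd_mono (Multiset.le_add_left _ _) φ

theorem bd_nsmul (n : ℕ) (κ : Multiset k) (φ : QuasiAbs R) : bd (n • κ) φ = bd κ φ ^ n := by
  induction n with
  | zero => simp
  | succ n ih => rw [succ_nsmul, bd_add, ih, pow_succ]

theorem C_le_bd_singleton (c : k) (φ : QuasiAbs R) : φ.C ≤ bd {c} φ := by
  simp only [bd, Multiset.map_singleton, Multiset.prod_singleton]
  exact le_mul_of_one_le_right φ.C_nonneg (le_max_left _ _)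

theorem le_bd_singleton (c : k) (φ : QuasiAbs R) : φ (algebraMap k R c) ≤ bd {c} φ := by
  simp only [bd, Multiset.map_singleton, Multiset.prod_singleton]
  exact (le_max_right _ _).trans
    (le_mul_of_one_le_left (zero_le_one.trans (le_max_left _ _)) φ.one_le_C)

/-- A real valued function on quasi-absolute values that is bounded in terms of constants. -/
def Adm (k : Type*) {R : Type*} [CommRing R] [CommRing k] [Algebra k R]
    (Φ : Set (QuasiAbs R)) (f : QuasiAbs R → ℝ) : Prop :=
  ∃ κ : Multiset k, ∀ φ ∈ Φ, f φ ≤ bd κ φ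

variable {Φ : Set (QuasiAbs R)} {f g : QuasiAbs R → ℝ}

/-- The constant 0 contributes exactly `φ.C` to `bd`; this is how factors `C` are absorbed into a
multiset of constants. -/
theorem adm_C : Adm k Φ (fun φ => φ.C) := ⟨{0}, fun φ _ => C_le_bd_singleton 0 φ⟩

theorem adm_const (c : k) : Adm k Φ (fun φ => φ (algebraMap k R c)) :=
  ⟨{c}, fun φ _ => le_bd_singleton c φ⟩

theorem Adm.pow (hf : Adm k Φ f) (h0 : ∀ φ ∈ Φ, 0 ≤ f φ) (n : ℕ) :
    Adm k Φ (fun φ => f φ ^ n) := by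
  obtain ⟨κ, hκ⟩ := hf
  refine ⟨n • κ, fun φ hφ => ?_⟩
  rw [bd_nsmul]
  exact pow_le_pow_left₀ (h0 φ hφ) (hκ φ hφ) n

theorem adm_finset {ι : Type*} (s : Finset ι) {f : ι → QuasiAbs R → ℝ}
    (h : ∀ i ∈ s, Adm k Φ (f i)) :
    ∃ κ : Multiset k, ∀ φ ∈ Φ, ∀ i ∈ s, f i φ ≤ bd κ φ := by
  choose! κ hκ using h
  refine ⟨∑ i ∈ s, κ i, fun φ hφ i hi => (hκ i hi φ hφ).trans (bd_mono ?_ φ)⟩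
  exact Finset.single_le_sum (fun _ _ => Multiset.zero_le _) hi

/-- The maximum over the coordinates. -/
noncomputable def nm (φ : QuasiAbs R) {ι : Type*} (x : ι → R) : ℝ := ⨆ i, φ (x i)

section nm

variable {ι : Type*} [Finite ι] (φ : QuasiAbs R) (x : ι → R)

theorem le_nm (i : ι) : φ (x i) ≤ φ.nm x := Finite.le_ciSup (fun i => φ (x i)) i

theorem nm_nonneg {ι : Type*} (x : ι → R) : 0 ≤ φ.nm x := Real.iSup_nonneg fun _ => φ.nonneg _

theorem nm_le {ι : Type*} {x : ι → R} {B : ℝ} (hB : 0 ≤ B) (h : ∀ i, φ (x i) ≤ B) : φ.nm x ≤ B :=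
  Real.iSup_le h hB

theorem exists_nm_eq [Nonempty ι] : ∃ i, φ.nm x = φ (x i) := by
  obtain ⟨i, hi⟩ := exists_eq_ciSup_of_finite (f := fun i => φ (x i))
  exact ⟨i, hi.symm⟩

theorem nm_two (x : Fin 2 → R) : φ.nm x = max (φ (x 0)) (φ (x 1)) := by
  refine le_antisymm (φ.nm_le (le_max_of_le_left (φ.nonneg _)) fun i => ?_)
    (max_le (φ.le_nm x 0) (φ.le_nm x 1))
  fin_cases i
  · exact le_max_left _ _
  · exact le_max_right _ _

end nm

end QuasiAbs

/-! ### Binary forms and rational maps -/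

section Forms

variable {R S : Type*} [CommRing R] [CommRing S]

theorem aeval_homogenize_eq_sum [Algebra R S] (p : R[X]) (d : ℕ) (x : Fin 2 → S) :
    MvPolynomial.aeval x (p.homogenize d) =
      ∑ i ∈ Finset.HasAntidiagonal.antidiagonal d, algebraMap R S (p.coeff i.1) * (x 0 ^ i.1 * x 1 ^ i.2) := by
  unfold Polynomial.homogenize
  rw [map_sum]
  refine Finset.sum_congr rfl fun i _ => ?_
  rw [MvPolynomial.aeval_monomial, Finsupp.prod_fintype _ _ (fun _ => pow_zero _)]
  simp [Fin.prod_univ_two]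

open QuasiAbs

theorem QuasiAbs.adm_form (p : R[X]) (d : ℕ) : ∃ κ : Multiset R, ∀ (φ : QuasiAbs R) (x : Fin 2 → R),
    φ (MvPolynomial.aeval x (p.homogenize d)) ≤ bd κ φ * φ.nm x ^ d := by
  obtain ⟨κ, hκ⟩ := adm_finset (k := R) (Φ := Set.univ) (Finset.range (d + 1))
    (f := fun i φ => φ (p.coeff i)) (fun i _ => adm_const (p.coeff i))
  obtain ⟨κ', hκ'⟩ := (adm_C (k := R) (R := R) (Φ := Set.univ)).pow (fun φ _ => φ.C_nonneg)
    (Finset.HasAntidiagonal.antidiagonal d).card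
  refine ⟨κ' + κ, fun φ x => ?_⟩
  rw [aeval_homogenize_eq_sum, bd_add, mul_assoc]
  have h0 : 0 ≤ bd κ φ * φ.nm x ^ d := mul_nonneg (bd_pos _ _).le (pow_nonneg (φ.nm_nonneg x) _)
  refine (φ.sum_le _ _ h0 fun i hi => ?_).trans
    (mul_le_mul_of_nonneg_right (hκ' φ trivial) h0)
  have hi' := Finset.HasAntidiagonal.mem_antidiagonal.mp hi
  simp only [Algebra.algebraMap_self, RingHom.id_apply, QuasiAbs.map_mul, QuasiAbs.map_pow]
  refine mul_le_mul (hκ φ trivial i.1 (by simp; omega)) ?_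
    (mul_nonneg (pow_nonneg (φ.nonneg _) _) (pow_nonneg (φ.nonneg _) _)) (bd_pos _ _).le
  rw [← hi', pow_add]
  exact mul_le_mul (pow_le_pow_left₀ (φ.nonneg _) (φ.le_nm x 0) _)
    (pow_le_pow_left₀ (φ.nonneg _) (φ.le_nm x 1) _) (pow_nonneg (φ.nonneg _) _)
    (pow_nonneg (φ.nm_nonneg x) _)

/-- A form with invertible leading coefficient in the variable `x 0` controls that variable. -/
theorem QuasiAbs.adm_form_leading (p : R[X]) (hp : IsUnit p.leadingCoeff) :
    ∃ κ : Multiset R, ∀ (φ : QuasiAbs R) (x : Fin 2 → R),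
      φ (x 0) ^ p.natDegree ≤ bd κ φ *
        max (φ (MvPolynomial.aeval x (p.homogenize p.natDegree)))
          (φ (x 1) * φ.nm x ^ (p.natDegree - 1)) := by
  set d := p.natDegree with hd
  obtain ⟨u, hu⟩ := hp
  obtain ⟨κ, hκ⟩ := adm_finset (k := R) (Φ := Set.univ) (Finset.range (d + 1))
    (f := fun i φ => φ (p.coeff i)) (fun i _ => adm_const (p.coeff i))
  obtain ⟨κ', hκ'⟩ := (adm_C (k := R) (R := R) (Φ := Set.univ)).pow (fun φ _ => φ.C_nonneg)
    ((Finset.HasAntidiagonal.antidiagonal d).erase (d, 0)).card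
  obtain ⟨κ₁, hκ₁⟩ := adm_C (k := R) (R := R) (Φ := Set.univ)
  obtain ⟨κ₂, hκ₂⟩ := adm_const (R := R) (k := R) (Φ := Set.univ) (↑u⁻¹ : R)
  refine ⟨κ₂ + (κ₁ + (κ' + κ)), fun φ x => ?_⟩
  set r := ∑ i ∈ (Finset.HasAntidiagonal.antidiagonal d).erase (d, 0),
    p.coeff i.1 * (x 0 ^ i.1 * x 1 ^ i.2) with hr
  have hmem : ((d, 0) : ℕ × ℕ) ∈ Finset.HasAntidiagonal.antidiagonal d :=
    Finset.HasAntidiagonal.mem_antidiagonal.mpr (by simp)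
  have e1 : MvPolynomial.aeval x (p.homogenize d) = ↑u * x 0 ^ d + r := by
    rw [aeval_homogenize_eq_sum, ← Finset.add_sum_erase _ _ hmem, hr, hu, hd]
    simp
  have e2 : x 0 ^ d = ↑u⁻¹ * (MvPolynomial.aeval x (p.homogenize d) + -r) := by
    rw [e1, add_neg_cancel_right, Units.inv_mul_cancel_left]
  have hrb : φ r ≤ bd (κ' + κ) φ * (φ (x 1) * φ.nm x ^ (d - 1)) := by
    have h1 : 0 ≤ φ (x 1) * φ.nm x ^ (d - 1) :=
      mul_nonneg (φ.nonneg _) (pow_nonneg (φ.nm_nonneg x) _)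
    have h0 : 0 ≤ bd κ φ * (φ (x 1) * φ.nm x ^ (d - 1)) := mul_nonneg (bd_pos _ _).le h1
    rw [bd_add, mul_assoc]
    refine (φ.sum_le _ _ h0 fun i hi => ?_).trans (mul_le_mul_of_nonneg_right (hκ' φ trivial) h0)
    obtain ⟨hi1, hi2⟩ := Finset.mem_erase.mp hi
    have hi' := Finset.HasAntidiagonal.mem_antidiagonal.mp hi2
    have hpos : i.2 ≠ 0 := by
      intro h
      exact hi1 (Prod.ext (by simp; omega) h)
    obtain ⟨l, hl⟩ := Nat.exists_eq_succ_of_ne_zero hpos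
    simp only [QuasiAbs.map_mul, QuasiAbs.map_pow]
    refine mul_le_mul (hκ φ trivial i.1 (by simp; omega)) ?_
      (mul_nonneg (pow_nonneg (φ.nonneg _) _) (pow_nonneg (φ.nonneg _) _)) (bd_pos _ _).le
    have : d - 1 = i.1 + l := by omega
    rw [hl, pow_succ', this, pow_add, mul_left_comm]
    refine mul_le_mul_of_nonneg_left ?_ (φ.nonneg _)
    exact mul_le_mul (pow_le_pow_left₀ (φ.nonneg _) (φ.le_nm x 0) _)
      (pow_le_pow_left₀ (φ.nonneg _) (φ.le_nm x 1) _) (pow_nonneg (φ.nonneg _) _)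
      (pow_nonneg (φ.nm_nonneg x) _)
  rw [← QuasiAbs.map_pow, e2, QuasiAbs.map_mul, bd_add, bd_add κ₁, mul_assoc, mul_assoc]
  refine mul_le_mul (hκ₂ φ trivial) ?_ (φ.nonneg _) (bd_pos _ _).le
  refine (φ.add_le _ _).trans ?_
  refine mul_le_mul (hκ₁ φ trivial) ?_ (le_max_of_le_left (φ.nonneg _)) (bd_pos _ _).le
  rw [QuasiAbs.map_neg]
  refine max_le ?_ (hrb.trans (mul_le_mul_of_nonneg_left (le_max_right _ _) (bd_pos _ _).le))
  exact (le_max_left _ _).trans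
    (le_mul_of_one_le_left (le_max_of_le_left (φ.nonneg _)) (one_le_bd _ _))

/-- If Y is the maximum, `h₂` alone suffices. If X is, then either `h₁` gives X^d ≤ b₁N at once, or
X ≤ b₁Y and `h₂` applies at the cost of b₁^(d+E). -/
theorem pow_le_of_two_bounds {b₁ b₂ N X Y T : ℝ} {d E : ℕ} (hd : 1 ≤ d) (hb₁ : 1 ≤ b₁)
    (hb₂ : 1 ≤ b₂) (hN : 0 ≤ N) (hX : 0 ≤ X) (hY : 0 ≤ Y) (hT : T = max X Y)
    (h₁ : X ^ d ≤ b₁ * max N (Y * T ^ (d - 1))) (h₂ : Y ^ (d + E) ≤ b₂ * N * T ^ E) :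
    T ^ d ≤ b₁ ^ (d + E) * b₂ * N := by
  have hT0 : 0 ≤ T := hT ▸ le_max_of_le_left hX
  rcases hT0.eq_or_lt with h0 | h0
  · rw [← h0, zero_pow (by omega)]
    positivity
  have hb : (1 : ℝ) ≤ b₁ ^ (d + E) := one_le_pow₀ hb₁
  have key : ∀ c : ℝ, 0 ≤ c → c ≤ b₁ ^ (d + E) → T ^ (d + E) ≤ c * (b₂ * N * T ^ E) →
      T ^ d ≤ b₁ ^ (d + E) * b₂ * N := by
    intro c hc hcb h
    have : T ^ d ≤ c * (b₂ * N) := by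
      refine le_of_mul_le_mul_right ?_ (pow_pos h0 E)
      rw [← pow_add]
      linarith
    refine this.trans ?_
    rw [mul_assoc]
    exact mul_le_mul_of_nonneg_right hcb (by positivity)
  rcases le_total X Y with hXY | hXY
  · rw [max_eq_right hXY] at hT
    refine key 1 zero_le_one hb ?_
    rw [one_mul]
    subst hT
    exact h₂
  · rw [max_eq_left hXY] at hT
    rcases le_total N (Y * T ^ (d - 1)) with h | h
    · rw [max_eq_right h, ← hT] at h₁
      have hT1 : T ≤ b₁ * Y := by
        refine le_of_mul_le_mul_right ?_ (pow_pos h0 (d - 1))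
        calc T * T ^ (d - 1) = T ^ d := by rw [← pow_succ', Nat.sub_add_cancel hd]
          _ ≤ _ := by linarith
      refine key (b₁ ^ (d + E)) (by positivity) le_rfl ?_
      calc T ^ (d + E) ≤ (b₁ * Y) ^ (d + E) := pow_le_pow_left₀ hT0 hT1 _
        _ = b₁ ^ (d + E) * Y ^ (d + E) := mul_pow _ _ _
        _ ≤ _ := mul_le_mul_of_nonneg_left h₂ (by positivity)
    · rw [max_eq_left h, ← hT] at h₁
      refine h₁.trans (mul_le_mul_of_nonneg_right ?_ hN)
      calc b₁ ≤ b₁ ^ (d + E) := le_self_pow₀ hb₁ (by omega)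
        _ ≤ _ := le_mul_of_one_le_right (by positivity) hb₂

theorem ratLift_zero [Algebra R S] (p q : R[X]) (x : Fin 2 → S) :
    ratLift p q x 0 = MvPolynomial.aeval x (p.homogenize (ratDegree p q)) := rfl

theorem ratLift_one [Algebra R S] (p q : R[X]) (x : Fin 2 → S) :
    ratLift p q x 1 = MvPolynomial.aeval x (q.homogenize (ratDegree p q)) := rfl

theorem QuasiAbs.adm_ratLift_le (p q : R[X]) : ∃ κ : Multiset R, ∀ (φ : QuasiAbs R) (x : Fin 2 → R),
    φ.nm (ratLift p q x) ≤ bd κ φ * φ.nm x ^ ratDegree p q := by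
  obtain ⟨κ, hκ⟩ := adm_form p (ratDegree p q)
  obtain ⟨κ', hκ'⟩ := adm_form q (ratDegree p q)
  refine ⟨κ + κ', fun φ x => ?_⟩
  have hT : 0 ≤ φ.nm x ^ ratDegree p q := pow_nonneg (φ.nm_nonneg x) _
  rw [nm_two, ratLift_zero, ratLift_one]
  exact max_le ((hκ φ x).trans (mul_le_mul_of_nonneg_right (bd_le_left _ _ _) hT))
    ((hκ' φ x).trans (mul_le_mul_of_nonneg_right (bd_le_right _ _ _) hT))

/-- The identity UP + VQ = Res, homogenised in degree d + E, becomes Res·y^(d+E) and bounds the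
second coordinate. The first is controlled by the unit leading coefficient of whichever of P, Q has
degree d. -/
theorem QuasiAbs.le_adm_ratLift (p q : R[X]) (hd : 1 ≤ ratDegree p q)
    (hres : IsUnit (resultant p q)) (hp : IsUnit p.leadingCoeff) (hq : IsUnit q.leadingCoeff) :
    ∃ κ : Multiset R, ∀ (φ : QuasiAbs R) (x : Fin 2 → R),
      φ.nm x ^ ratDegree p q ≤ bd κ φ * φ.nm (ratLift p q x) := by
  set d := ratDegree p q with hdd
  have hlead : ∃ κ : Multiset R, ∀ (φ : QuasiAbs R) (x : Fin 2 → R),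
      φ (x 0) ^ d ≤ bd κ φ * max (φ.nm (ratLift p q x)) (φ (x 1) * φ.nm x ^ (d - 1)) := by
    rcases le_total q.natDegree p.natDegree with h | h
    · have h' : d = p.natDegree := max_eq_left h
      obtain ⟨κ, hκ⟩ := adm_form_leading p hp
      refine ⟨κ, fun φ x => ?_⟩
      have := hκ φ x
      rw [← h'] at this
      refine this.trans (mul_le_mul_of_nonneg_left (max_le_max_right _ ?_) (bd_pos _ _).le)
      exact φ.le_nm (ratLift p q x) 0
    · have h' : d = q.natDegree := max_eq_right h
      obtain ⟨κ, hκ⟩ := adm_form_leading q hq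
      refine ⟨κ, fun φ x => ?_⟩
      have := hκ φ x
      rw [← h'] at this
      refine this.trans (mul_le_mul_of_nonneg_left (max_le_max_right _ ?_) (bd_pos _ _).le)
      exact φ.le_nm (ratLift p q x) 1
  obtain ⟨κ₁, hκ₁⟩ := hlead
  have hmn : p.natDegree ≠ 0 ∨ q.natDegree ≠ 0 := by
    by_contra! h
    rw [hdd, ratDegree, h.1, h.2] at hd
    simp at hd
  obtain ⟨U, V, -, -, hUV⟩ := exists_mul_add_mul_eq_C_resultant p q le_rfl le_rfl hmn
  set E := max U.natDegree V.natDegree with hE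
  obtain ⟨ρ, hρ⟩ := hres
  obtain ⟨κU, hκU⟩ := adm_form U E
  obtain ⟨κV, hκV⟩ := adm_form V E
  obtain ⟨κC, hκC⟩ := adm_C (k := R) (R := R) (Φ := Set.univ)
  obtain ⟨κρ, hκρ⟩ := adm_const (R := R) (k := R) (Φ := Set.univ) (↑ρ⁻¹ : R)
  refine ⟨(d + E) • κ₁ + (κρ + κC + (κU + κV)), fun φ x => ?_⟩
  rw [bd_add, bd_nsmul]
  refine pow_le_of_two_bounds hd (one_le_bd _ _) (one_le_bd _ _) (φ.nm_nonneg _) (φ.nonneg _)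
    (φ.nonneg _) (φ.nm_two x) (hκ₁ φ x) ?_
  have e1 : x 1 ^ (d + E) = ↑ρ⁻¹ * (ratLift p q x 0 * MvPolynomial.aeval x (U.homogenize E) +
      ratLift p q x 1 * MvPolynomial.aeval x (V.homogenize E)) := by
    rw [ratLift_zero, ratLift_one, ← map_mul, ← map_mul,
      ← homogenize_mul p U (m := ratDegree p q) (n := E) (le_max_left _ _) (le_max_left _ _),
      ← homogenize_mul q V (m := ratDegree p q) (n := E) (le_max_right _ _) (le_max_right _ _), ← map_add, ← homogenize_add,
      hUV, homogenize_C, ← hρ]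
    simp [hdd]
  have hT : 0 ≤ φ.nm x ^ E := pow_nonneg (φ.nm_nonneg x) _
  have hN := φ.nm_nonneg (ratLift p q x)
  rw [← QuasiAbs.map_pow, e1, QuasiAbs.map_mul, bd_add, bd_add κρ, mul_assoc, mul_assoc, mul_assoc]
  refine mul_le_mul (hκρ φ trivial) ?_ (φ.nonneg _) (bd_pos _ _).le
  refine (φ.add_le _ _).trans ?_
  refine mul_le_mul (hκC φ trivial) (max_le ?_ ?_) (le_max_of_le_left (φ.nonneg _)) (bd_pos _ _).le
  · rw [QuasiAbs.map_mul, mul_left_comm]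
    refine mul_le_mul (φ.le_nm _ 0) ((hκU φ x).trans ?_) (φ.nonneg _) hN
    exact mul_le_mul_of_nonneg_right (bd_le_left _ _ _) hT
  · rw [QuasiAbs.map_mul, mul_left_comm]
    refine mul_le_mul (φ.le_nm _ 1) ((hκV φ x).trans ?_) (φ.nonneg _) hN
    exact mul_le_mul_of_nonneg_right (bd_le_right _ _ _) hT

end Forms

/-! ### Places of a function field -/

namespace Place

variable {K F : Type*} [Field K] [Field F] [Algebra K F]

theorem val_le_one_iff (p : Place K F) (x : F) : p.val x ≤ 1 ↔ x ∈ p.ring := by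
  constructor
  · intro h
    obtain ⟨y, rfl⟩ := IsDiscreteValuationRing.exists_lift_of_le_one h
    exact y.2
  · intro h
    exact IsDedekindDomain.HeightOneSpectrum.valuation_le_one
      (IsDiscreteValuationRing.maximalIdeal p.ring) (⟨x, h⟩ : p.ring)

theorem val_algebraMap (p : Place K F) {c : K} (hc : c ≠ 0) : p.val (algebraMap K F c) = 1 := by
  refine le_antisymm ((p.val_le_one_iff _).mpr (p.ring.algebraMap_mem c)) ?_
  have h := (p.val_le_one_iff _).mpr (p.ring.algebraMap_mem c⁻¹)
  rw [map_inv₀, map_inv₀] at h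
  exact (inv_le_one₀ (zero_lt_iff.mpr (by simpa using hc))).mp h

theorem val_regular_le (η p : Place K F) (hp : p ≠ η) (x : η.regularRing) : p.val (x : F) ≤ 1 :=
  (p.val_le_one_iff _).mpr (regularRing_le hp x.2)

theorem mem_regularRing_iff (η : Place K F) (x : F) :
    x ∈ η.regularRing ↔ ∀ p : Place K F, p ≠ η → p.val x ≤ 1 := by
  simp only [regularRing, Algebra.mem_iInf, val_le_one_iff]

end Place

/-! ### Valuation rings of F over K are local rings of closed points -/

section ValuationRings

variable {K F : Type*} [Field K] [Field F] [Algebra K F]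

theorem IsCurveFunctionField.finite_adjoin (hF : IsCurveFunctionField K F) {t : F}
    (ht : Transcendental K t) : FiniteDimensional (IntermediateField.adjoin K {t}) F := by
  have hind : AlgebraicIndependent K (fun _ : Unit => t) := algebraicIndependent_unique_type_iff.mpr ht
  have hb : IsTranscendenceBasis K (fun _ : Unit => t) := by
    refine hind.isTranscendenceBasis_of_lift_trdeg_le_of_finite ?_
    rw [hF.trdeg_eq_one]; simp
  have halg := hb.isAlgebraic_field
  rw [Set.range_const] at halg
  have : Algebra.EssFiniteType K F := IntermediateField.fg_top_iff.mp hF.fg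
  have : Algebra.EssFiniteType (IntermediateField.adjoin K {t}) F :=
    Algebra.EssFiniteType.of_comp K _ F
  exact Algebra.finite_of_essFiniteType_of_isAlgebraic

theorem ValuationSubring.mem_of_isIntegral {A : Type*} [CommRing A] [Algebra A F]
    (V : ValuationSubring F) (hA : ∀ c : A, algebraMap A F c ∈ V) {x : F} (hx : IsIntegral A x) :
    x ∈ V := by
  let f : A →+* V := (algebraMap A F).codRestrict V.toSubring hA
  obtain ⟨p, hp, hx⟩ := hx
  have hx' : IsIntegral V x := by
    refine ⟨p.map f, hp.map f, ?_⟩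
    rw [eval₂_map]
    exact hx
  obtain ⟨z, rfl⟩ := IsIntegrallyClosed.isIntegral_iff.mp hx'
  exact z.2

theorem IsDedekindDomain.HeightOneSpectrum.isDVR_valuationSubringAtPrime {R : Type*} [CommRing R]
    [IsDedekindDomain R] [Algebra R F] [IsFractionRing R F]
    (v : IsDedekindDomain.HeightOneSpectrum R) :
    IsDiscreteValuationRing (v.valuationSubringAtPrime F) := by
  have : IsLocalization.AtPrime (v.valuationSubringAtPrime F) v.asIdeal :=
    inferInstanceAs (IsLocalization v.asIdeal.primeCompl (v.valuationSubringAtPrime F))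
  exact IsLocalization.AtPrime.isDiscreteValuationRing_of_dedekind_domain R v.ne_bot _

open scoped IntermediateField.algebraAdjoinAdjoin in
-- An element y outside V gives a transcendental t = 1/y in the maximal ideal. V contains the
-- integral closure B of K[t] in F, a Dedekind domain. The localisation of B at the prime cut out by
-- the maximal ideal is a discrete valuation ring inside V, and such a ring has no larger proper
-- valuation ring above it.
theorem IsCurveFunctionField.isDVR [CharZero K] (hF : IsCurveFunctionField K F)
    (V : ValuationSubring F)
    (hK : ∀ c : K, algebraMap K F c ∈ V) (hV : V ≠ ⊤) : IsDiscreteValuationRing V := by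
  obtain ⟨y, hy⟩ : ∃ y, y ∉ V := by
    by_contra! h
    exact hV (eq_top_iff.mpr fun x _ => h x)
  have ht : Transcendental K y⁻¹ := by
    intro h
    exact hy (V.mem_of_isIntegral hK (inv_inv y ▸ h.inv).isIntegral)
  set t := y⁻¹ with htdef
  have htV : t ∈ V := (V.mem_or_inv_mem y).resolve_left hy
  have htn : t ∈ V.nonunits := V.inv_mem_nonunits_iff.mpr (Or.inr hy)
  have : FiniteDimensional (IntermediateField.adjoin K {t}) F := hF.finite_adjoin ht
  have hAV : ∀ x ∈ Algebra.adjoin K {t}, x ∈ V := by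
    intro x hx
    induction hx using Algebra.adjoin_induction with
    | mem x hx => rw [Set.mem_singleton_iff.mp hx]; exact htV
    | algebraMap c => exact hK c
    | add x y _ _ h1 h2 => exact add_mem h1 h2
    | mul x y _ _ h1 h2 => exact mul_mem h1 h2
  have : IsPrincipalIdealRing (Algebra.adjoin K {t}) := by
    rw [Algebra.adjoin_singleton_eq_range_aeval]
    exact IsPrincipalIdealRing.of_surjective (Polynomial.aeval (R := K) t).rangeRestrict.toRingHom
      (Polynomial.aeval (R := K) t).rangeRestrict_surjective
  have : CharZero F := charZero_of_injective_algebraMap (algebraMap K F).injective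
  have : CharZero (IntermediateField.adjoin K {t}) := inferInstance
  let B := integralClosure (Algebra.adjoin K {t}) F
  have : IsDedekindDomain B :=
    integralClosure.isDedekindDomain (Algebra.adjoin K {t}) (IntermediateField.adjoin K {t}) F
  have : IsFractionRing B F :=
    integralClosure.isFractionRing_of_finite_extension (IntermediateField.adjoin K {t}) F
  have hBV : ∀ b : B, (b : F) ∈ V := by
    intro b
    exact V.mem_of_isIntegral (fun c : Algebra.adjoin K {t} => hAV c c.2) b.2
  let f : B →+* V := (algebraMap B F).codRestrict V.toSubring hBV
  have hP0 : (IsLocalRing.maximalIdeal V).comap f ≠ ⊥ := by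
    have ht0 : t ≠ 0 := by
      intro h
      exact ht (h ▸ isAlgebraic_zero)
    let tB : B := algebraMap (Algebra.adjoin K {t}) B ⟨t, Algebra.self_mem_adjoin_singleton K t⟩
    refine fun h => ht0 ?_
    have : tB ∈ (IsLocalRing.maximalIdeal V).comap f := by
      rw [← SetLike.mem_coe, ← V.image_maximalIdeal] at htn
      obtain ⟨t', ht', hteq⟩ := htn
      rw [Ideal.mem_comap]
      convert ht'
      exact Subtype.ext hteq.symm
    rw [h, Ideal.mem_bot] at this
    exact congrArg (algebraMap B F) this
  let v : IsDedekindDomain.HeightOneSpectrum B :=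
    ⟨(IsLocalRing.maximalIdeal V).comap f, inferInstance, hP0⟩
  have hle : v.valuationSubringAtPrime F ≤ V := by
    rintro x ⟨a, s, hs, rfl⟩
    have hs' : IsUnit (f s) := by
      by_contra h
      exact hs h
    obtain ⟨u, hu⟩ := hs'
    have e : (algebraMap B F s)⁻¹ = ((u⁻¹ : Vˣ) : V) := by
      have h1 : ((u : V) : F) * ((u⁻¹ : Vˣ) : V) = 1 := congrArg Subtype.val u.mul_inv
      rw [hu] at h1
      exact inv_eq_of_mul_eq_one_right h1
    rw [e]
    exact mul_mem (hBV a) (Subtype.mem _)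
  have hVeq := ValuationSubring.eq_of_le_of_ne_top _ hle hV
  rw [← hVeq]
  exact v.isDVR_valuationSubringAtPrime

theorem IsCurveFunctionField.exists_place [CharZero K] (hF : IsCurveFunctionField K F)
    (V : ValuationSubring F) (hK : ∀ c : K, algebraMap K F c ∈ V) (hV : V ≠ ⊤) :
    ∃ p : Place K F, ∀ x, x ∈ p.ring ↔ x ∈ V := by
  have := hF.isDVR V hK hV
  let A : Subalgebra K F := { V.toSubring with algebraMap_mem' := hK }
  have h1 : IsDiscreteValuationRing A := inferInstanceAs (IsDiscreteValuationRing V)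
  have h2 : IsFractionRing A F := inferInstanceAs (IsFractionRing V F)
  exact ⟨⟨A, h1, h2⟩, fun x => Iff.rfl⟩

/-- If all the `x i / y` lie in a proper ideal of the ring that they generate over `K`, then
some place sees `y` as strictly larger than all the `x i`. -/
theorem IsCurveFunctionField.exists_aeval_eq_one [CharZero K] (hF : IsCurveFunctionField K F)
    {ι : Type*} [Fintype ι] (z : ι → F) (hz : ∃ i, z i ≠ 0)
    (h : ∀ p : Place K F, ∃ i, 1 ≤ p.val (z i)) :
    ∃ G : MvPolynomial ι K, MvPolynomial.constantCoeff G = 0 ∧ MvPolynomial.aeval z G = 1 := by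
  let A : Subalgebra K F := Algebra.adjoin K (Set.range z)
  let w : ι → A := fun i => ⟨z i, Algebra.subset_adjoin ⟨i, rfl⟩⟩
  let I : Ideal A := Ideal.span (Set.range w)
  have hI : I = ⊤ := by
    by_contra hI
    obtain ⟨V, hAV, hIV⟩ := Ideal.image_subset_nonunits_valuationSubring (A := A.toSubring) I hI
    have hzV : ∀ i, z i ∈ V.nonunits := fun i =>
      hIV ⟨w i, Ideal.subset_span ⟨i, rfl⟩, rfl⟩
    have hV : V ≠ ⊤ := by
      intro hVtop
      obtain ⟨i, hi⟩ := hz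
      rcases V.mem_nonunits_iff_or.mp (hzV i) with h | h
      · exact hi h
      · exact h (hVtop ▸ ValuationSubring.mem_top _)
    obtain ⟨p, hp⟩ := hF.exists_place V (fun c => hAV (A.algebraMap_mem c)) hV
    obtain ⟨i, hi⟩ := h p
    rcases V.mem_nonunits_iff_or.mp (hzV i) with h | h
    · rw [h] at hi; simp at hi
    · rw [← hp, ← p.val_le_one_iff, map_inv₀] at h
      exact h (inv_le_one_of_one_le₀ hi)
  have h1 : (1 : A) ∈ I := hI ▸ Submodule.mem_top
  obtain ⟨c, hc⟩ := (Ideal.mem_span_range_iff_exists_fun).mp h1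
  have hrange : ∀ a : A, ∃ H : MvPolynomial ι K, MvPolynomial.aeval z H = (a : F) := by
    intro a
    exact (Algebra.adjoin_range_eq_range_aeval K z).le a.2
  choose H hH using hrange
  -- Every summand carries a variable, so the constant coefficient vanishes.
  refine ⟨∑ i, H (c i) * MvPolynomial.X i, by simp, ?_⟩
  rw [map_sum]
  simp only [map_mul, MvPolynomial.aeval_X, hH]
  have := congrArg (Subtype.val) hc
  simpa using this

end ValuationRings

/-! ### Comparison of functions -/

section Comparison

variable {K F : Type*} [Field K] [Field F] [Algebra K F]

open QuasiAbs

theorem Place.exists_le_val_of_le_sup {ι : Type*} [Fintype ι] [Nonempty ι] {p : Place K F} {y : F}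
    {x : ι → F} (h : p.val y ≤ Finset.univ.sup fun i => p.val (x i)) :
    ∃ i, p.val y ≤ p.val (x i) := by
  obtain ⟨i, -, hi⟩ := Finset.exists_mem_eq_sup Finset.univ Finset.univ_nonempty
    fun i => p.val (x i)
  exact ⟨i, hi ▸ h⟩

/-- A homogeneous polynomial relation expressing that `y` is integral over the `x i`. -/
theorem pow_eq_sum_of_aeval_eq_one {ι : Type*} [Fintype ι] {y : F} (hy : y ≠ 0) {x : ι → F}
    {G : MvPolynomial ι K} (hG : MvPolynomial.aeval (fun i => x i / y) G = 1) :
    y ^ G.totalDegree = ∑ e ∈ G.support, algebraMap K F (G.coeff e) *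
      ((∏ i, x i ^ e i) * y ^ (G.totalDegree - ∑ i, e i)) := by
  rw [MvPolynomial.aeval_def, MvPolynomial.eval₂_eq'] at hG
  rw [← mul_one (y ^ _), ← hG, Finset.mul_sum]
  refine Finset.sum_congr rfl fun e he => ?_
  have hle : ∑ i, e i ≤ G.totalDegree := by
    have := MvPolynomial.le_totalDegree he
    rwa [Finsupp.sum_fintype _ _ fun _ => rfl] at this
  obtain ⟨l, hl⟩ := Nat.exists_eq_add_of_le hle
  have h2 : ∏ i, (x i / y) ^ e i = (∏ i, x i ^ e i) / y ^ (∑ i, e i) := by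
    simp only [div_pow, Finset.prod_div_distrib, Finset.prod_pow_eq_pow_sum]
  have h3 : y ^ (∑ i, e i) ≠ 0 := pow_ne_zero _ hy
  rw [h2, hl, Nat.add_sub_cancel_left, pow_add]
  field_simp

/-- The hypothesis yields y^r = Σ c_e x^e y^(r-|e|) with c_e in K and 1 ≤ |e| ≤ r. If φ(y) exceeds
the maximum T of the φ(x_i), every monomial is at most T·φ(y)^(r-1), and φ(y)^(r-1) cancels. The
coefficients lie in K and not merely in A, which is what makes the bound uniform. -/
theorem IsCurveFunctionField.adm_le [CharZero K] (hF : IsCurveFunctionField K F) (η : Place K F)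
    {ι : Type*} [Fintype ι] [Nonempty ι] (y : η.regularRing) (x : ι → η.regularRing)
    (h : ∀ p : Place K F, p.val (y : F) ≤ Finset.univ.sup fun i => p.val (x i : F)) :
    ∃ κ : Multiset K, ∀ φ : QuasiAbs η.regularRing, φ y ≤ bd κ φ * φ.nm x := by
  by_cases hy : y = 0
  · subst hy
    exact ⟨0, fun φ => by simpa using φ.nm_nonneg x⟩
  have hy' : (y : F) ≠ 0 := by simpa using hy
  have hle : ∀ p : Place K F, ∃ i, 1 ≤ p.val ((x i : F) / y) := by
    intro p
    obtain ⟨i, hi⟩ := Place.exists_le_val_of_le_sup (h p)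
    refine ⟨i, ?_⟩
    rw [map_div₀]
    exact (one_le_div₀ (zero_lt_iff.mpr ((Valuation.ne_zero_iff _).mpr hy'))).mpr hi
  have hz : ∃ i, (x i : F) / y ≠ 0 := by
    obtain ⟨i, hi⟩ := hle η
    refine ⟨i, fun h0 => ?_⟩
    rw [h0] at hi
    simp at hi
  obtain ⟨G, hG0, hG⟩ := hF.exists_aeval_eq_one (fun i => (x i : F) / y) hz hle
  have key := pow_eq_sum_of_aeval_eq_one hy' hG
  set r := G.totalDegree with hr
  have key' : y ^ r = ∑ e ∈ G.support, algebraMap K η.regularRing (G.coeff e) *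
      ((∏ i, x i ^ e i) * y ^ (r - ∑ i, e i)) := by
    apply Subtype.ext
    push_cast
    exact key
  have hdeg : ∀ e ∈ G.support, 1 ≤ ∑ i, e i ∧ ∑ i, e i ≤ r := by
    intro e he
    constructor
    · by_contra! hlt
      have he0 : e = 0 := by
        ext i
        have := (Finset.sum_eq_zero_iff.mp (by omega : ∑ i, e i = 0)) i (Finset.mem_univ i)
        simpa using this
      rw [he0, MvPolynomial.mem_support_iff] at he
      exact he (by simpa [MvPolynomial.constantCoeff_eq] using hG0)
    · have := MvPolynomial.le_totalDegree he
      rwa [Finsupp.sum_fintype _ _ fun _ => rfl] at this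
  have hr1 : 1 ≤ r := by
    have hGne : G.support.Nonempty := by
      rw [MvPolynomial.support_nonempty]
      rintro rfl
      simp at hG
    obtain ⟨e, he⟩ := hGne
    exact (hdeg e he).1.trans (hdeg e he).2
  obtain ⟨κ, hκ⟩ := adm_finset (k := K) (R := η.regularRing) (Φ := Set.univ) G.support
    (f := fun e φ => φ (algebraMap K η.regularRing (G.coeff e))) (fun e _ => adm_const (G.coeff e))
  obtain ⟨κ', hκ'⟩ := (adm_C (k := K) (R := η.regularRing) (Φ := Set.univ)).pow
    (fun φ _ => φ.C_nonneg) G.support.card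
  refine ⟨κ' + κ, fun φ => ?_⟩
  have hX := φ.nm_nonneg x
  rcases le_total (φ y) (φ.nm x) with hle | hle
  · exact hle.trans (le_mul_of_one_le_left hX (one_le_bd _ _))
  rcases (φ.nonneg y).eq_or_lt with hy0 | hy0
  · rw [← hy0]
    exact mul_nonneg (bd_pos _ _).le hX
  refine le_of_mul_le_mul_right ?_ (pow_pos hy0 (r - 1))
  have h0 : 0 ≤ bd κ φ * (φ.nm x * φ y ^ (r - 1)) := by
    have := (bd_pos κ φ).le
    positivity
  calc φ y * φ y ^ (r - 1) = φ (y ^ r) := by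
        rw [← pow_succ', Nat.sub_add_cancel hr1, QuasiAbs.map_pow]
    _ ≤ φ.C ^ G.support.card * (bd κ φ * (φ.nm x * φ y ^ (r - 1))) := by
        rw [key']
        refine φ.sum_le _ _ h0 fun e he => ?_
        obtain ⟨h1, h2⟩ := hdeg e he
        rw [QuasiAbs.map_mul, QuasiAbs.map_mul, QuasiAbs.map_prod, QuasiAbs.map_pow]
        refine mul_le_mul (hκ φ trivial e he) ?_
          (mul_nonneg (Finset.prod_nonneg fun i _ => φ.nonneg _) (by positivity)) (bd_pos _ _).le
        have h3 : ∏ i, φ (x i ^ e i) ≤ φ.nm x ^ (∑ i, e i) := by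
          rw [← Finset.prod_pow_eq_pow_sum]
          refine Finset.prod_le_prod (fun i _ => φ.nonneg _) fun i _ => ?_
          rw [QuasiAbs.map_pow]
          exact pow_le_pow_left₀ (φ.nonneg _) (φ.le_nm x i) _
        obtain ⟨l, hl⟩ := Nat.exists_eq_add_of_le h1
        have h4 : φ.nm x ^ (∑ i, e i) ≤ φ.nm x * φ y ^ l := by
          rw [hl, pow_add, pow_one]
          exact mul_le_mul_of_nonneg_left (pow_le_pow_left₀ hX hle _) hX
        calc (∏ i, φ (x i ^ e i)) * φ y ^ (r - ∑ i, e i)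
            ≤ φ.nm x * φ y ^ l * φ y ^ (r - ∑ i, e i) :=
              mul_le_mul_of_nonneg_right (h3.trans h4) (by positivity)
          _ = φ.nm x * φ y ^ (r - 1) := by
              rw [mul_assoc, ← pow_add]
              congr 2
              omega
    _ ≤ bd κ' φ * (bd κ φ * (φ.nm x * φ y ^ (r - 1))) :=
        mul_le_mul_of_nonneg_right (hκ' φ trivial) h0
    _ = bd (κ' + κ) φ * φ.nm x * φ y ^ (r - 1) := by rw [bd_add]; ring

/-- With no pole anywhere, 1/y has value at least 1 at every place, so G(1/y) = 1 for some G without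
constant term. Thus y is algebraic over K, which is algebraically closed in F. -/
theorem IsCurveFunctionField.exists_algebraMap_eq [CharZero K] (hF : IsCurveFunctionField K F)
    (η : Place K F) (y : η.regularRing) (hy : η.val (y : F) ≤ 1) :
    ∃ c : K, (y : F) = algebraMap K F c := by
  by_cases hy0 : (y : F) = 0
  · exact ⟨0, by simpa using hy0⟩
  have hle : ∀ p : Place K F, p.val (y : F) ≤ 1 := by
    intro p
    by_cases hp : p = η
    · exact hp ▸ hy
    · exact Place.val_regular_le η p hp y
  obtain ⟨G, hG0, hG⟩ := hF.exists_aeval_eq_one (fun _ : Unit => (y : F)⁻¹)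
    ⟨(), inv_ne_zero hy0⟩ fun p => ⟨(), by
      rw [map_inv₀]
      exact (one_le_inv₀ (zero_lt_iff.mpr ((Valuation.ne_zero_iff _).mpr hy0))).mpr (hle p)⟩
  have halg : IsAlgebraic K (y : F)⁻¹ := by
    by_contra ht
    have hind : AlgebraicIndependent K (fun _ : Unit => (y : F)⁻¹) :=
      algebraicIndependent_unique_type_iff.mpr ht
    have := algebraicIndependent_iff.mp hind (G - 1) (by simp [hG])
    rw [sub_eq_zero.mp this] at hG0
    simp at hG0
  have hmem : (y : F) ∈ algebraicClosure K F :=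
    mem_algebraicClosure_iff.mpr (inv_inv (y : F) ▸ halg.inv)
  rw [hF.algClosed, IntermediateField.mem_bot] at hmem
  obtain ⟨c, hc⟩ := hmem
  exact ⟨c, hc.symm⟩

theorem IsCurveFunctionField.one_le_val [CharZero K] (hF : IsCurveFunctionField K F)
    (η : Place K F) {y : η.regularRing} (hy : y ≠ 0) : 1 ≤ η.val (y : F) := by
  by_contra! h
  obtain ⟨c, hc⟩ := hF.exists_algebraMap_eq η y h.le
  have hc0 : c ≠ 0 := by
    rintro rfl
    exact hy (Subtype.ext (by simpa using hc))
  rw [hc, η.val_algebraMap hc0] at h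
  exact lt_irrefl _ h

theorem IsCurveFunctionField.isNonzeroConstant_of_isUnit [CharZero K]
    (hF : IsCurveFunctionField K F) (η : Place K F) {y : η.regularRing} (hy : IsUnit y) :
    IsNonzeroConstant K y := by
  obtain ⟨u, rfl⟩ := hy
  have h1 := hF.one_le_val η (y := ((u⁻¹ : (η.regularRing)ˣ) : η.regularRing)) (Units.ne_zero _)
  have h2 : η.val ((u : η.regularRing) : F) *
      η.val (((u⁻¹ : (η.regularRing)ˣ) : η.regularRing) : F) = 1 := by
    rw [← map_mul, ← Subalgebra.coe_mul, Units.mul_inv]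
    simp
  have h3 : η.val ((u : η.regularRing) : F) ≤ 1 := h2 ▸ le_mul_of_one_le_right' h1
  obtain ⟨c, hc⟩ := hF.exists_algebraMap_eq η _ h3
  refine ⟨c, ?_, Subtype.ext hc⟩
  rintro rfl
  rw [map_zero] at hc
  exact u.ne_zero (Subtype.ext hc)

end Comparison

/-! ### Growth of regular functions -/

section Growth

variable {K F : Type*} [Field K] [Field F] [Algebra K F]

open QuasiAbs

/-- The size of a point, measured by generating sections of a multiple of `η`. -/
noncomputable def QuasiAbs.size {η : Place K F} {r : ℕ} (s : Fin r → η.regularRing) (m : ℕ)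
    (φ : QuasiAbs η.regularRing) : ℝ := φ.nm s ^ (1 / m : ℝ)

variable {η : Place K F} {r m : ℕ} {s : Fin r → η.regularRing}

theorem QuasiAbs.size_nonneg (φ : QuasiAbs η.regularRing) : 0 ≤ φ.size s m :=
  Real.rpow_nonneg (φ.nm_nonneg s) _

theorem QuasiAbs.size_pow (hm : 1 ≤ m) (φ : QuasiAbs η.regularRing) : φ.size s m ^ m = φ.nm s := by
  rw [size, ← Real.rpow_natCast, ← Real.rpow_mul (φ.nm_nonneg s), one_div,
    inv_mul_cancel₀ (by positivity), Real.rpow_one]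

theorem GeneratesMultiple.nonempty (hs : GeneratesMultiple η m s) : Nonempty (Fin r) := by
  by_contra h
  rw [not_nonempty_iff] at h
  have := hs.2
  rw [Finset.univ_eq_empty, Finset.sup_empty] at this
  exact WithZero.coe_ne_zero this.symm

theorem GeneratesMultiple.le_eta (hs : GeneratesMultiple η m s) (i : Fin r) :
    η.val (s i : F) ≤ WithZero.exp (m : ℤ) :=
  hs.2 ▸ Finset.le_sup (f := fun i => η.val (s i : F)) (Finset.mem_univ i)

theorem sup_pow_eq {ι : Type*} [Fintype ι] [Nonempty ι] (f : ι → ℤᵐ⁰) (n : ℕ) :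
    (Finset.univ.sup fun i => f i ^ n) = (Finset.univ.sup f) ^ n := by
  apply le_antisymm
  · exact Finset.sup_le fun i hi => pow_le_pow_left' (Finset.le_sup hi) n
  · obtain ⟨i, -, hi⟩ := Finset.exists_mem_eq_sup Finset.univ Finset.univ_nonempty f
    rw [hi]
    exact Finset.le_sup (f := fun i => f i ^ n) (Finset.mem_univ i)

theorem QuasiAbs.nm_pow_le {R : Type*} [CommRing R] {ι : Type*} [Finite ι] (φ : QuasiAbs R)
    (x : ι → R) (n : ℕ) : φ.nm (fun i => x i ^ n) ≤ φ.nm x ^ n := by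
  refine φ.nm_le (pow_nonneg (φ.nm_nonneg x) n) fun i => ?_
  rw [QuasiAbs.map_pow]
  exact pow_le_pow_left₀ (φ.nonneg _) (φ.le_nm x i) n

variable [CharZero K]

/-- At η both g^m and the s_i^D are measured against a pole of order mD; elsewhere the s_i^D have no
common zero. So `adm_le` applies to g^m and the s_i^D. -/
theorem IsCurveFunctionField.adm_le_size_pow (hF : IsCurveFunctionField K F) (hm : 1 ≤ m)
    (hs : GeneratesMultiple η m s) (g : η.regularRing) (D : ℕ)
    (hg : η.val (g : F) ≤ WithZero.exp (D : ℤ)) :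
    ∃ κ : Multiset K, ∀ φ : QuasiAbs η.regularRing, φ g ≤ bd κ φ * φ.size s m ^ D := by
  have := hs.nonempty
  obtain ⟨κ, hκ⟩ := hF.adm_le η (g ^ m) (fun i => s i ^ D) (by
    intro p
    simp only [Subalgebra.coe_pow, map_pow]
    rw [sup_pow_eq fun i => p.val (s i : F)]
    by_cases hp : p = η
    · subst hp
      rw [hs.2]
      refine (pow_le_pow_left' hg m).trans (le_of_eq ?_)
      rw [← WithZero.exp_nsmul, ← WithZero.exp_nsmul]
      simp [mul_comm]
    · rw [hs.1 p hp, one_pow]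
      exact pow_le_one' (Place.val_regular_le η p hp g) m)
  refine ⟨κ, fun φ => ?_⟩
  have h1 := hκ φ
  rw [QuasiAbs.map_pow] at h1
  have hb := one_le_bd κ φ
  have hS := pow_nonneg (φ.size_nonneg (s := s) (m := m)) D
  refine le_of_pow_le_pow_left₀ (n := m) (by omega) (mul_nonneg (bd_pos _ _).le hS) ?_
  calc φ g ^ m ≤ bd κ φ * φ.nm s ^ D :=
        h1.trans (mul_le_mul_of_nonneg_left (φ.nm_pow_le s D) (bd_pos _ _).le)
    _ = bd κ φ * (φ.size s m ^ D) ^ m := by rw [← φ.size_pow (s := s) hm, ← pow_mul, ← pow_mul, mul_comm D]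
    _ ≤ bd κ φ ^ m * (φ.size s m ^ D) ^ m :=
        mul_le_mul_of_nonneg_right (le_self_pow₀ hb (by omega)) (pow_nonneg hS _)
    _ = _ := (mul_pow _ _ _).symm

theorem IsCurveFunctionField.adm_one_le_size (hF : IsCurveFunctionField K F) (hm : 1 ≤ m)
    (hs : GeneratesMultiple η m s) :
    ∃ κ : Multiset K, ∀ φ : QuasiAbs η.regularRing, 1 ≤ bd κ φ * φ.size s m := by
  have := hs.nonempty
  obtain ⟨κ, hκ⟩ := hF.adm_le η 1 s (by
    intro p
    rw [Subalgebra.coe_one, map_one]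
    by_cases hp : p = η
    · subst hp
      rw [hs.2, ← WithZero.exp_zero, WithZero.exp_le_exp]
      positivity
    · rw [hs.1 p hp])
  refine ⟨κ, fun φ => ?_⟩
  have h1 := hκ φ
  rw [QuasiAbs.map_one] at h1
  have hb := one_le_bd κ φ
  refine le_of_pow_le_pow_left₀ (n := m) (by omega)
    (mul_nonneg (bd_pos _ _).le φ.size_nonneg) ?_
  rw [one_pow, mul_pow, φ.size_pow hm]
  exact h1.trans (mul_le_mul_of_nonneg_right (le_self_pow₀ hb (by omega)) (φ.nm_nonneg s))

/-- At η the power g^m dominates the s_i^D. At the other places, where g may vanish, the constant 1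
in the maximum does. -/
theorem IsCurveFunctionField.adm_size_pow_le (hF : IsCurveFunctionField K F) (hm : 1 ≤ m)
    (hs : GeneratesMultiple η m s) (g : η.regularRing) (D : ℕ)
    (hg : WithZero.exp (D : ℤ) ≤ η.val (g : F)) :
    ∃ κ : Multiset K, ∀ φ : QuasiAbs η.regularRing,
      φ.size s m ^ D ≤ bd κ φ * max (φ g) 1 := by
  have := hs.nonempty
  have h : ∀ i, ∃ κ : Multiset K, ∀ φ : QuasiAbs η.regularRing,
      φ (s i ^ D) ≤ bd κ φ * φ.nm ![g ^ m, 1] := by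
    intro i
    refine hF.adm_le η (s i ^ D) ![g ^ m, 1] fun p => ?_
    by_cases hp : p = η
    · subst hp
      refine le_trans ?_ (Finset.le_sup (Finset.mem_univ 0))
      simp only [Subalgebra.coe_pow, map_pow, Matrix.cons_val_zero]
      refine (pow_le_pow_left' (hs.le_eta i) D).trans (le_trans (le_of_eq ?_)
        (pow_le_pow_left' hg m))
      rw [← WithZero.exp_nsmul, ← WithZero.exp_nsmul]
      simp [mul_comm]
    · refine le_trans ?_ (Finset.le_sup (Finset.mem_univ 1))
      simp only [Matrix.cons_val_one, Matrix.cons_val_fin_one, Subalgebra.coe_one, map_one]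
      exact Place.val_regular_le η p hp _
  choose κ hκ using h
  refine ⟨∑ i, κ i, fun φ => ?_⟩
  obtain ⟨i, hi⟩ := φ.exists_nm_eq s
  have hle : bd (κ i) φ ≤ bd (∑ i, κ i) φ :=
    bd_mono (Finset.single_le_sum (fun _ _ => Multiset.zero_le _) (Finset.mem_univ i)) φ
  have hb := one_le_bd (∑ i, κ i) φ
  have hmax : 0 ≤ max (φ g) 1 := le_max_of_le_left (φ.nonneg _)
  refine le_of_pow_le_pow_left₀ (n := m) (by omega)
    (mul_nonneg (bd_pos _ _).le hmax) ?_
  calc (φ.size s m ^ D) ^ m = φ (s i ^ D) := by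
        rw [← pow_mul, mul_comm, pow_mul, φ.size_pow hm, hi, QuasiAbs.map_pow]
    _ ≤ bd (κ i) φ * φ.nm ![g ^ m, 1] := hκ i φ
    _ ≤ bd (∑ i, κ i) φ * max (φ g) 1 ^ m := by
        refine mul_le_mul hle (φ.nm_le (pow_nonneg hmax m) fun j => ?_) (φ.nm_nonneg _)
          (bd_pos _ _).le
        fin_cases j
        · simpa using pow_le_pow_left₀ (φ.nonneg _) (le_max_left _ _) m
        · simpa using one_le_pow₀ (le_max_right (φ g) 1)
    _ ≤ bd (∑ i, κ i) φ ^ m * max (φ g) 1 ^ m :=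
        mul_le_mul_of_nonneg_right (le_self_pow₀ hb (by omega)) (pow_nonneg hmax _)
    _ = _ := (mul_pow _ _ _).symm

theorem exists_val_le_exp (x : ℤᵐ⁰) : ∃ D : ℕ, x ≤ WithZero.exp (D : ℤ) := by
  by_cases hx : x = 0
  · exact ⟨0, by simp [hx]⟩
  · refine ⟨(WithZero.log x).toNat, ?_⟩
    rw [← WithZero.log_le_iff_le_exp hx]
    exact Int.self_le_toNat _

/-- In a region of bounded size, all constants of the ring of regular functions are bounded by
constants of the ground field. -/
theorem IsCurveFunctionField.adm_bd_of_size_le (hF : IsCurveFunctionField K F) (hm : 1 ≤ m)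
    (hs : GeneratesMultiple η m s) (κ₀ : Multiset K) (κ : Multiset η.regularRing) :
    ∃ κ' : Multiset K, ∀ φ : QuasiAbs η.regularRing, φ.size s m ≤ bd κ₀ φ →
      bd κ φ ≤ bd κ' φ := by
  induction κ using Multiset.induction_on with
  | empty => exact ⟨0, fun φ _ => by simp⟩
  | cons g κ ih =>
    obtain ⟨κ₁, h₁⟩ := ih
    obtain ⟨D, hD⟩ := exists_val_le_exp (η.val (g : F))
    obtain ⟨κ₂, h₂⟩ := hF.adm_le_size_pow hm hs g D hD
    refine ⟨{0} + (κ₂ + D • κ₀) + κ₁, fun φ hφ => ?_⟩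
    rw [bd_cons, bd_add, bd_add, bd_add, bd_nsmul]
    have hb : 1 ≤ bd κ₂ φ * bd κ₀ φ ^ D :=
      one_le_mul_of_one_le_of_one_le (one_le_bd _ _) (one_le_pow₀ (one_le_bd _ _))
    refine mul_le_mul (mul_le_mul (C_le_bd_singleton 0 φ) (max_le hb ?_)
      (zero_le_one.trans (le_max_left _ _)) (bd_pos _ _).le) (h₁ φ hφ) (bd_pos _ _).le
      (mul_nonneg (bd_pos _ _).le (zero_le_one.trans hb))
    exact (h₂ φ).trans (mul_le_mul_of_nonneg_left
      (pow_le_pow_left₀ φ.size_nonneg hφ D) (bd_pos _ _).le)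

end Growth

/-! ### The absolute value at `η` -/

namespace Place

variable {K F : Type*} [Field K] [Field F] [Algebra K F]

open Classical in
/-- The real valued multiplicative absolute value at a place. -/
noncomputable def quasiAbs (η : Place K F) : QuasiAbs F where
  toFun x := if x = 0 then 0 else Real.exp ((WithZero.log (η.val x) : ℤ) : ℝ)
  C := 1
  one_le_C := le_rfl
  nonneg' x := by split_ifs; exacts [le_rfl, (Real.exp_pos _).le]
  map_zero' := by simp
  map_one' := by simp
  map_mul' x y := by
    by_cases hx : x = 0
    · simp [hx]
    by_cases hy : y = 0
    · simp [hy]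
    rw [if_neg (mul_ne_zero hx hy), if_neg hx, if_neg hy, map_mul,
      WithZero.log_mul ((Valuation.ne_zero_iff _).mpr hx) ((Valuation.ne_zero_iff _).mpr hy),
      Int.cast_add, Real.exp_add]
  add_le' x y := by
    rw [one_mul]
    by_cases hx : x = 0
    · simp [hx]
    by_cases hy : y = 0
    · simp [hy]
    by_cases hxy : x + y = 0
    · rw [if_pos hxy, if_neg hx]
      exact le_max_of_le_left (Real.exp_pos _).le
    rw [if_neg hx, if_neg hy, if_neg hxy, le_max_iff, Real.exp_le_exp, Real.exp_le_exp,
      Int.cast_le, Int.cast_le]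
    have hx' := (Valuation.ne_zero_iff η.val).mpr hx
    have hy' := (Valuation.ne_zero_iff η.val).mpr hy
    have hxy' := (Valuation.ne_zero_iff η.val).mpr hxy
    rw [WithZero.log_le_log hxy' hx', WithZero.log_le_log hxy' hy', ← le_max_iff]
    exact η.val.map_add x y

theorem quasiAbs_apply (η : Place K F) {x : F} (hx : x ≠ 0) :
    η.quasiAbs x = Real.exp ((WithZero.log (η.val x) : ℤ) : ℝ) := if_neg hx

theorem quasiAbs_algebraMap (η : Place K F) {c : K} (hc : c ≠ 0) :
    η.quasiAbs (algebraMap K F c) = 1 := by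
  rw [quasiAbs_apply _ (by simpa using hc), val_algebraMap _ hc]
  simp

/-- Here C = 1 and constants of K have absolute value at most 1, so at η the error terms disappear
and estimates become equalities. -/
theorem bd_quasiAbs (η : Place K F) (κ : Multiset K) :
    QuasiAbs.bd κ (η.quasiAbs.comp (algebraMap η.regularRing F)) = 1 := by
  unfold QuasiAbs.bd
  rw [Multiset.prod_eq_one]
  intro x hx
  obtain ⟨c, -, rfl⟩ := Multiset.mem_map.mp hx
  have h1 : (η.quasiAbs.comp (algebraMap η.regularRing F)).C = 1 := rfl
  rw [h1, one_mul, QuasiAbs.comp_apply, ← IsScalarTower.algebraMap_apply]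
  by_cases hc : c = 0
  · simp [hc]
  · rw [quasiAbs_algebraMap η hc, max_self]

theorem log_nm_quasiAbs (η : Place K F) {ι : Type*} [Fintype ι] [Nonempty ι] {x : ι → F}
    (hx : ∃ i, x i ≠ 0) :
    Real.log (η.quasiAbs.nm x) =
      ((WithZero.log (Finset.univ.sup fun i => η.val (x i)) : ℤ) : ℝ) := by
  obtain ⟨i, -, hi⟩ := Finset.exists_mem_eq_sup Finset.univ Finset.univ_nonempty
    fun i => η.val (x i)
  have hxi : x i ≠ 0 := by
    rintro h0
    obtain ⟨j, hj⟩ := hx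
    rw [h0, map_zero] at hi
    have := Finset.le_sup (f := fun i => η.val (x i)) (Finset.mem_univ j)
    rw [hi] at this
    exact (Valuation.ne_zero_iff η.val).mpr hj (le_zero_iff.mp this)
  have : η.quasiAbs.nm x = η.quasiAbs (x i) := by
    refine le_antisymm (QuasiAbs.nm_le _ (QuasiAbs.nonneg _ _) fun j => ?_)
      (QuasiAbs.le_nm _ x i)
    by_cases hj : x j = 0
    · rw [hj, QuasiAbs.map_zero]
      exact QuasiAbs.nonneg _ _
    rw [quasiAbs_apply η hj, quasiAbs_apply η hxi, Real.exp_le_exp, Int.cast_le,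
      WithZero.log_le_log ((Valuation.ne_zero_iff η.val).mpr hj)
        ((Valuation.ne_zero_iff η.val).mpr hxi), ← hi]
    exact Finset.le_sup (f := fun i => η.val (x i)) (Finset.mem_univ j)
  rw [this, quasiAbs_apply η hxi, Real.log_exp, hi]

end Place

/-! ### Iterates of rational maps -/

section Iterates

universe u

theorem ratLift_map {R R' S S' : Type*} [CommRing R] [CommRing R'] [CommRing S] [CommRing S']
    [Algebra R S] [Algebra R' S'] (f : R →+* R') (g : S →+* S')
    (hfg : ∀ r, g (algebraMap R S r) = algebraMap R' S' (f r)) (p q : R[X])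
    (hd : ratDegree (p.map f) (q.map f) = ratDegree p q) (x : Fin 2 → S) :
    ratLift (p.map f) (q.map f) (fun i => g (x i)) = fun i => g (ratLift p q x i) := by
  have key : ∀ P : R[X], MvPolynomial.aeval (fun i => g (x i))
      ((P.map f).homogenize (ratDegree p q)) =
        g (MvPolynomial.aeval x (P.homogenize (ratDegree p q))) := by
    intro P
    rw [aeval_homogenize_eq_sum, aeval_homogenize_eq_sum, map_sum]
    refine Finset.sum_congr rfl fun i _ => ?_
    simp [hfg]
  funext i
  fin_cases i
  · exact (by rw [ratLift_zero, hd, key, ← ratLift_zero] :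
      ratLift (p.map f) (q.map f) (fun i => g (x i)) 0 = g (ratLift p q x 0))
  · exact (by rw [ratLift_one, hd, key, ← ratLift_one] :
      ratLift (p.map f) (q.map f) (fun i => g (x i)) 1 = g (ratLift p q x 1))

theorem ratLift_iterate_map {R R' S S' : Type*} [CommRing R] [CommRing R'] [CommRing S]
    [CommRing S'] [Algebra R S] [Algebra R' S'] (f : R →+* R') (g : S →+* S')
    (hfg : ∀ r, g (algebraMap R S r) = algebraMap R' S' (f r)) (p q : R[X])
    (hd : ratDegree (p.map f) (q.map f) = ratDegree p q) (n : ℕ) (x : Fin 2 → S) :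
    (ratLift (p.map f) (q.map f))^[n] (fun i => g (x i)) =
      fun i => g ((ratLift p q)^[n] x i) := by
  induction n with
  | zero => rfl
  | succ n ih =>
    rw [Function.iterate_succ_apply', Function.iterate_succ_apply', ih, ratLift_map f g hfg p q hd]

variable {R : Type u} [CommRing R]

/-- One pair of forms computes the iterate in every algebra `S`; both `S = R` and `S = R[X]` are
used to pass between points and polynomials in w = 1/x. -/
theorem exists_iterate_form (p q : R[X]) (n : ℕ) :
    ∃ G : Fin 2 → MvPolynomial (Fin 2) R, (∀ i, (G i).IsHomogeneous (ratDegree p q ^ n)) ∧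
      ∀ (S : Type u) [CommRing S] [Algebra R S] (x : Fin 2 → S) (i : Fin 2),
        (ratLift p q)^[n] x i = MvPolynomial.aeval x (G i) := by
  induction n with
  | zero => exact ⟨MvPolynomial.X, fun i => by simpa using MvPolynomial.isHomogeneous_X R i,
      fun S _ _ x i => by simp⟩
  | succ n ih =>
    obtain ⟨G, hG, hx⟩ := ih
    let H : Fin 2 → MvPolynomial (Fin 2) R := ![p.homogenize (ratDegree p q),
      q.homogenize (ratDegree p q)]
    have hH : ∀ i, (H i).IsHomogeneous (ratDegree p q) := by
      intro i
      fin_cases i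
      exacts [isHomogeneous_homogenize p, isHomogeneous_homogenize q]
    refine ⟨fun i => MvPolynomial.aeval G (H i), fun i => ?_, fun S _ _ x i => ?_⟩
    · rw [pow_succ]
      exact (hH i).aeval _ hG
    · rw [Function.iterate_succ_apply']
      have e : (ratLift p q)^[n] x = fun i => MvPolynomial.aeval x (G i) := funext (hx S x)
      rw [e, ← AlgHom.comp_apply, MvPolynomial.comp_aeval]
      fin_cases i <;> rfl

/-- Starting from [1 : w] the iterate is a pair of polynomials in w = x₁/x₀, and homogenising in
degree d^n recovers it at any point. The coordinates are swapped because `homogenize` puts the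
variable of the polynomial at index 0. -/
theorem ratLift_iterate_eq (p q : R[X]) (n : ℕ) (x : Fin 2 → R) (i : Fin 2) :
    (ratLift p q)^[n] x i = MvPolynomial.aeval ![x 1, x 0]
      (((ratLift p q)^[n] ![(1 : R[X]), X] i).homogenize (ratDegree p q ^ n)) := by
  obtain ⟨G, hG, hx⟩ := exists_iterate_form p q n
  have h1 : (MvPolynomial.rename (Equiv.swap (0 : Fin 2) 1) (G i)).IsHomogeneous
      (ratDegree p q ^ n) := (hG i).rename_isHomogeneous
  have hv : ∀ (S : Type u) [CommRing S] [Algebra R S] (a b : S),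
      ![b, a] ∘ Equiv.swap (0 : Fin 2) 1 = ![a, b] := by
    intro S _ _ a b
    funext j
    fin_cases j <;> simp
  have h2 := homogenize_eq_of_isHomogeneous (p := (ratLift p q)^[n] ![(1 : R[X]), X] i) h1 (by
    rw [MvPolynomial.aeval_rename, hv, hx])
  rw [h2, MvPolynomial.aeval_rename, hv, hx]
  congr
  funext j
  fin_cases j <;> rfl

end Iterates

/-! ### The basin of attraction of a superattracting point -/

section Basin

variable {R : Type*} [CommRing R]

/-- The basin is defined by φ(b)τ^(D+1) ≤ Bφ(a), where τ^D is the size allowed to the coefficients.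
There v₀(0)a^δ dominates all other terms of the first form, while the double zero of v₁ makes the
second form quadratic in b, so the basin is preserved. The last two bounds say that φ(a) is raised
to the power δ up to B². -/
theorem QuasiAbs.basin_step (φ : QuasiAbs R) {v₀ v₁ : R[X]} {δ D : ℕ} {B τ : ℝ} {a b : R}
    (hδ : 2 ≤ δ) (hτ : B ^ (δ + 6) < τ) (hB : 1 ≤ B) (hC : φ.C ≤ B)
    (hv₀ : ∀ i ≤ δ, φ (v₀.coeff i) ≤ B * τ ^ D) (hv₁ : ∀ i ≤ δ, φ (v₁.coeff i) ≤ B * τ ^ D)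
    (hβ : φ (v₀.coeff 0) ≤ B) (hβ' : 1 ≤ B * φ (v₀.coeff 0))
    (h10 : v₁.coeff 0 = 0) (h11 : v₁.coeff 1 = 0)
    (ha : 0 < φ a) (hab : φ b * τ ^ (D + 1) ≤ B * φ a) :
    0 < φ (MvPolynomial.aeval ![b, a] (v₀.homogenize δ)) ∧
      φ (MvPolynomial.aeval ![b, a] (v₁.homogenize δ)) * τ ^ (D + 1) ≤
        B * φ (MvPolynomial.aeval ![b, a] (v₀.homogenize δ)) ∧
      φ (MvPolynomial.aeval ![b, a] (v₀.homogenize δ)) ≤ B ^ 2 * φ a ^ δ ∧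
      φ a ^ δ ≤ B ^ 2 * φ (MvPolynomial.aeval ![b, a] (v₀.homogenize δ)) := by
  set h₀ := MvPolynomial.aeval ![b, a] (v₀.homogenize δ) with hh₀
  set h₁ := MvPolynomial.aeval ![b, a] (v₁.homogenize δ) with hh₁
  have hB0 : 0 < B := zero_lt_one.trans_le hB
  have hbn : 0 ≤ φ b := φ.nonneg b
  have hτB : ∀ k ≤ δ + 6, B ^ k < τ := fun k hk => (pow_le_pow_right₀ hB hk).trans_lt hτ
  have hτ1 : 1 < τ := by simpa using hτB 0 (by omega)
  have hτ0 : 0 < τ := zero_lt_one.trans hτ1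
  have hbA : φ b ≤ φ a := by
    refine le_of_mul_le_mul_right ?_ hB0
    calc φ b * B ≤ φ b * τ ^ (D + 1) := by
          refine mul_le_mul_of_nonneg_left ?_ hbn
          have h1 := hτB 1 (by omega)
          rw [pow_one] at h1
          exact h1.le.trans (le_self_pow₀ hτ1.le (by omega))
      _ ≤ φ a * B := by linarith
  have hCp : ∀ k, φ.C ^ k ≤ B ^ k := fun k => pow_le_pow_left₀ φ.C_nonneg hC k
  have hmon : ∀ k l, k + l ≤ δ → φ b ^ (k + l) * φ a ^ (δ - (k + l)) ≤ φ b ^ k * φ a ^ (δ - k) := by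
    intro k l hkl
    rw [pow_add, mul_assoc]
    refine mul_le_mul_of_nonneg_left ?_ (pow_nonneg hbn k)
    calc φ b ^ l * φ a ^ (δ - (k + l)) ≤ φ a ^ l * φ a ^ (δ - (k + l)) :=
          mul_le_mul_of_nonneg_right (pow_le_pow_left₀ hbn hbA l) (pow_nonneg ha.le _)
      _ = φ a ^ (δ - k) := by rw [← pow_add]; congr 1; omega
  have hterm : ∀ (v : R[X]) (k : ℕ), (∀ i ≤ δ, φ (v.coeff i) ≤ B * τ ^ D) →
      ∀ i ∈ Finset.HasAntidiagonal.antidiagonal δ, k ≤ i.1 →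
      φ (algebraMap R R (v.coeff i.1) * ((![b, a] : Fin 2 → R) 0 ^ i.1 * (![b, a] : Fin 2 → R) 1 ^ i.2)) ≤
        B * τ ^ D * (φ b ^ k * φ a ^ (δ - k)) := by
    intro v k hv i hi hki
    have hi' := Finset.HasAntidiagonal.mem_antidiagonal.mp hi
    obtain ⟨l, hl⟩ := Nat.exists_eq_add_of_le hki
    have h2 : i.2 = δ - (k + l) := by omega
    simp only [Algebra.algebraMap_self, RingHom.id_apply, QuasiAbs.map_mul, QuasiAbs.map_pow,
      Matrix.cons_val_zero, Matrix.cons_val_one, Matrix.cons_val_fin_one]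
    rw [h2, hl]
    exact mul_le_mul (hv _ (by omega)) (hmon k l (by omega))
      (mul_nonneg (pow_nonneg hbn _) (pow_nonneg ha.le _)) (by positivity)
  have hAδ : 0 < φ a ^ δ := pow_pos ha δ
  -- the main term of `h₀`
  obtain ⟨rest, hrest, hS⟩ : ∃ rest, h₀ = v₀.coeff 0 * a ^ δ + rest ∧
      φ rest * B ^ 4 < φ a ^ δ := by
    have hmem : ((0, δ) : ℕ × ℕ) ∈ Finset.HasAntidiagonal.antidiagonal δ :=
      Finset.HasAntidiagonal.mem_antidiagonal.mpr (by simp)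
    refine ⟨∑ i ∈ (Finset.HasAntidiagonal.antidiagonal δ).erase (0, δ),
      algebraMap R R (v₀.coeff i.1) * ((![b, a] : Fin 2 → R) 0 ^ i.1 * (![b, a] : Fin 2 → R) 1 ^ i.2), ?_, ?_⟩
    · rw [hh₀, aeval_homogenize_eq_sum, ← Finset.add_sum_erase _ _ hmem]
      simp
    · have hE : 0 ≤ B * τ ^ D * (φ b ^ 1 * φ a ^ (δ - 1)) := by positivity
      have h1 := φ.sum_le ((Finset.HasAntidiagonal.antidiagonal δ).erase (0, δ))
        (fun i => algebraMap R R (v₀.coeff i.1) *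
          ((![b, a] : Fin 2 → R) 0 ^ i.1 * (![b, a] : Fin 2 → R) 1 ^ i.2)) hE (by
          intro i hi
          obtain ⟨hi1, hi2⟩ := Finset.mem_erase.mp hi
          have hi' := Finset.HasAntidiagonal.mem_antidiagonal.mp hi2
          refine hterm v₀ 1 hv₀ i hi2 (Nat.one_le_iff_ne_zero.mpr fun h => hi1 ?_)
          exact Prod.ext h (by simp; omega))
      -- There are δ + 1 monomials, and the main one is removed, so the sum costs C^δ.
      rw [Finset.card_erase_of_mem hmem, Finset.Nat.card_antidiagonal, Nat.add_sub_cancel] at h1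
      refine lt_of_mul_lt_mul_right ?_ hτ0.le
      have e1 : φ a ^ δ = φ a * φ a ^ (δ - 1) := by
        rw [← pow_succ']; congr 1; omega
      -- The threshold: B^δ comes from the number of terms, B from the coefficients, B⁴ from the
      -- desired margin and B from `hab`, making B^(δ+6) in all.
      calc _ ≤ B ^ δ * (B * τ ^ D * (φ b ^ 1 * φ a ^ (δ - 1))) * B ^ 4 * τ := by
            gcongr
            exact h1.trans (mul_le_mul_of_nonneg_right (hCp δ) hE)
        _ = B ^ (δ + 5) * φ a ^ (δ - 1) * (φ b * τ ^ (D + 1)) := by ring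
        _ ≤ B ^ (δ + 5) * φ a ^ (δ - 1) * (B * φ a) := by gcongr
        _ = φ a ^ δ * B ^ (δ + 6) := by rw [e1]; ring
        _ < φ a ^ δ * τ := by gcongr
  have hM1 : φ a ^ δ ≤ B * φ (v₀.coeff 0 * a ^ δ) := by
    rw [QuasiAbs.map_mul, QuasiAbs.map_pow, ← mul_assoc]
    exact le_mul_of_one_le_left hAδ.le hβ'
  have hM2 : φ (v₀.coeff 0 * a ^ δ) ≤ B * φ a ^ δ := by
    rw [QuasiAbs.map_mul, QuasiAbs.map_pow]
    gcongr
  have hSB : ∀ k ≤ 4, B ^ k * φ rest < φ a ^ δ := by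
    intro k hk
    refine lt_of_le_of_lt ?_ hS
    rw [mul_comm]
    exact mul_le_mul_of_nonneg_left (pow_le_pow_right₀ hB hk) (φ.nonneg _)
  have hup : φ h₀ ≤ B ^ 2 * φ a ^ δ := by
    rw [hrest]
    refine (φ.add_le _ _).trans ?_
    rw [pow_two, mul_assoc]
    refine mul_le_mul hC (max_le hM2 ?_) (le_max_of_le_left (φ.nonneg _)) hB0.le
    have := hSB 0 (by omega)
    rw [pow_zero, one_mul] at this
    exact this.le.trans (le_mul_of_one_le_left hAδ.le hB)
  have hlow : φ a ^ δ ≤ B ^ 2 * φ h₀ := by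
    have h1 : φ (v₀.coeff 0 * a ^ δ) ≤ B * max (φ h₀) (φ rest) := by
      have e : v₀.coeff 0 * a ^ δ = h₀ + -rest := by rw [hrest]; ring
      rw [e]
      refine (φ.add_le _ _).trans ?_
      rw [QuasiAbs.map_neg]
      exact mul_le_mul_of_nonneg_right hC (le_max_of_le_left (φ.nonneg _))
    rcases le_total (φ h₀) (φ rest) with h | h
    · rw [max_eq_right h] at h1
      have := hSB 2 (by omega)
      nlinarith
    · rw [max_eq_left h] at h1
      calc φ a ^ δ ≤ B * φ (v₀.coeff 0 * a ^ δ) := hM1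
        _ ≤ B * (B * φ h₀) := by gcongr
        _ = B ^ 2 * φ h₀ := by ring
  have hpos : 0 < φ h₀ := by
    by_contra! h
    have : φ a ^ δ ≤ 0 := hlow.trans (mul_nonpos_of_nonneg_of_nonpos (by positivity) h)
    linarith
  refine ⟨hpos, ?_, hup, hlow⟩
  have hE : 0 ≤ B * τ ^ D * (φ b ^ 2 * φ a ^ (δ - 2)) := by positivity
  -- Only terms with at least b² survive. Two factors φ(b)τ^(D+1) absorb the τ^D of the
  -- coefficients, the τ^(D+1) of the invariant and one further τ, and that last τ beats B^(δ+6).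
  have h1 : φ h₁ ≤ B ^ (δ + 1) * (B * τ ^ D * (φ b ^ 2 * φ a ^ (δ - 2))) := by
    rw [hh₁, aeval_homogenize_eq_sum]
    refine (φ.sum_le _ _ hE fun i hi => ?_).trans (mul_le_mul_of_nonneg_right ?_ hE)
    · by_cases hi0 : i.1 = 0
      · rw [hi0, h10]; simpa using hE
      by_cases hi1 : i.1 = 1
      · rw [hi1, h11]; simpa using hE
      exact hterm v₁ 2 hv₁ i hi (by omega)
    · rw [Finset.Nat.card_antidiagonal]
      exact hCp _
  have e2 : φ a ^ δ = φ a * φ a * φ a ^ (δ - 2) := by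
    rw [← pow_two, ← pow_add]; congr 1; omega
  refine le_trans ?_ (le_mul_of_one_le_left hpos.le hB)
  refine le_of_mul_le_mul_right ?_ hτ0
  have hbτ : (φ b * τ ^ (D + 1)) * (φ b * τ ^ (D + 1)) ≤ (B * φ a) * (B * φ a) :=
    mul_le_mul hab hab (by positivity) (by positivity)
  calc φ h₁ * τ ^ (D + 1) * τ
      ≤ B ^ (δ + 1) * (B * τ ^ D * (φ b ^ 2 * φ a ^ (δ - 2))) * τ ^ (D + 1) * τ := by gcongr
    _ = B ^ (δ + 2) * φ a ^ (δ - 2) * ((φ b * τ ^ (D + 1)) * (φ b * τ ^ (D + 1))) := by ring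
    _ ≤ B ^ (δ + 2) * φ a ^ (δ - 2) * ((B * φ a) * (B * φ a)) := by gcongr
    _ = B ^ (δ + 4) * φ a ^ δ := by rw [e2]; ring
    _ ≤ B ^ (δ + 4) * (B ^ 2 * φ h₀) := by gcongr
    _ = φ h₀ * B ^ (δ + 6) := by ring
    _ ≤ φ h₀ * τ := by gcongr

end Basin

/-! ### The local estimate -/

theorem telescope_step {u : ℕ → ℝ} {q E : ℝ} (hq : 2 ≤ q) (h : ∀ j, |u (j + 1) - q * u j| ≤ E)
    (j : ℕ) : dist (u j / q ^ j) (u (j + 1) / q ^ (j + 1)) ≤ E / 2 / 2 ^ j := by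
  have hq0 : 0 < q := by linarith
  have hE : 0 ≤ E := (abs_nonneg _).trans (h 0)
  have e : u j / q ^ j - u (j + 1) / q ^ (j + 1) = -((u (j + 1) - q * u j) / q ^ (j + 1)) := by
    rw [pow_succ]
    field_simp
    ring
  rw [Real.dist_eq, e, abs_neg, abs_div, abs_of_pos (pow_pos hq0 (j + 1)), div_div, ← pow_succ']
  exact div_le_div₀ hE (h j) (by positivity) (pow_le_pow_left₀ (by norm_num) hq _)

theorem exists_tendsto_div_pow {u : ℕ → ℝ} {q E : ℝ} (hq : 2 ≤ q)
    (h : ∀ j, |u (j + 1) - q * u j| ≤ E) : ∃ l, Tendsto (fun j => u j / q ^ j) atTop (𝓝 l) :=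
  cauchySeq_tendsto_of_complete (cauchySeq_of_le_geometric_two (telescope_step hq h))

/-- The increments of u_j/q^j are at most E/2^(j+1), so they sum to at most E, uniformly in j and in
q ≥ 2. -/
theorem abs_div_pow_sub_le {u : ℕ → ℝ} {q E : ℝ} (hq : 2 ≤ q)
    (h : ∀ j, |u (j + 1) - q * u j| ≤ E) (j : ℕ) : |u j / q ^ j - u 0| ≤ E := by
  have hE : 0 ≤ E := (abs_nonneg _).trans (h 0)
  have key : ∀ j, |u j / q ^ j - u 0| ≤ E * (1 - 1 / 2 ^ j) := by
    intro j
    induction j with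
    | zero => simp
    | succ j ih =>
      have h1 := telescope_step hq h j
      rw [Real.dist_eq, abs_sub_comm] at h1
      have h2 := abs_sub_le (u (j + 1) / q ^ (j + 1)) (u j / q ^ j) (u 0)
      have e : E * (1 - 1 / 2 ^ (j + 1)) = E / 2 / 2 ^ j + E * (1 - 1 / 2 ^ j) := by
        rw [pow_succ]; field_simp; ring
      linarith
  refine (key j).trans (mul_le_of_le_one_right hE ?_)
  have : (0 : ℝ) < 1 / 2 ^ j := by positivity
  linarith

namespace QuasiAbs

theorem log_bd_nonneg {R k : Type*} [CommRing R] [CommRing k] [Algebra k R] (κ : Multiset k)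
    (φ : QuasiAbs R) : 0 ≤ Real.log (bd κ φ) := Real.log_nonneg (one_le_bd κ φ)

theorem log_bd_add {R k : Type*} [CommRing R] [CommRing k] [Algebra k R] (κ κ' : Multiset k)
    (φ : QuasiAbs R) : Real.log (bd (κ + κ') φ) = Real.log (bd κ φ) + Real.log (bd κ' φ) := by
  rw [bd_add, Real.log_mul (bd_pos _ _).ne' (bd_pos _ _).ne']

theorem log_bd_nsmul {R k : Type*} [CommRing R] [CommRing k] [Algebra k R] (n : ℕ)
    (κ : Multiset k) (φ : QuasiAbs R) : Real.log (bd (n • κ) φ) = n * Real.log (bd κ φ) := by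
  rw [bd_nsmul, Real.log_pow]

theorem log_bd_mono {R k : Type*} [CommRing R] [CommRing k] [Algebra k R] {κ κ' : Multiset k}
    (h : κ ≤ κ') (φ : QuasiAbs R) : Real.log (bd κ φ) ≤ Real.log (bd κ' φ) :=
  Real.log_le_log (bd_pos _ _) (bd_mono h φ)

end QuasiAbs

theorem abs_log_sub_le {x y B : ℝ} (hx : 0 < x) (hy : 0 < y) (hB : 0 < B) (h₁ : x ≤ B * y)
    (h₂ : y ≤ B * x) : |Real.log x - Real.log y| ≤ Real.log B := by
  have e₁ := Real.log_le_log hx h₁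
  have e₂ := Real.log_le_log hy h₂
  rw [Real.log_mul hB.ne' hy.ne'] at e₁
  rw [Real.log_mul hB.ne' hx.ne'] at e₂
  rw [abs_le]
  constructor <;> linarith

open QuasiAbs

/-! ### Tate's telescoping for a rational map with unit resultant -/

section Tate

variable {R : Type*} [CommRing R]

/-- The constants come from `R`. For `R = A` the error depends on the point, and becomes uniform
only where the size is bounded; for the existence of limits at a fixed point it is enough as it
stands. -/
theorem exists_abs_log_ratLift_sub_le (p q : R[X]) (hd : 1 ≤ ratDegree p q)
    (hres : IsUnit (resultant p q)) (hp : IsUnit p.leadingCoeff) (hq : IsUnit q.leadingCoeff) :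
    ∃ κ : Multiset R, ∀ (φ : QuasiAbs R) (x : Fin 2 → R), 0 < φ.nm x →
      0 < φ.nm (ratLift p q x) ∧
        |Real.log (φ.nm (ratLift p q x)) - ratDegree p q * Real.log (φ.nm x)| ≤
          Real.log (bd κ φ) := by
  obtain ⟨κ₁, h₁⟩ := adm_ratLift_le p q
  obtain ⟨κ₂, h₂⟩ := le_adm_ratLift p q hd hres hp hq
  refine ⟨κ₁ + κ₂, fun φ x hx => ?_⟩
  have hxd : 0 < φ.nm x ^ ratDegree p q := pow_pos hx _
  have hpos : 0 < φ.nm (ratLift p q x) := by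
    by_contra! h
    have := hxd.trans_le (h₂ φ x)
    exact absurd (mul_nonpos_of_nonneg_of_nonpos (bd_pos κ₂ φ).le h) (not_le.mpr this)
  refine ⟨hpos, ?_⟩
  rw [← Real.log_pow]
  refine abs_log_sub_le hpos hxd (bd_pos _ _)
    ((h₁ φ x).trans (mul_le_mul_of_nonneg_right (bd_le_left _ _ _) hxd.le))
    ((h₂ φ x).trans (mul_le_mul_of_nonneg_right (bd_le_right _ _ _) hpos.le))

theorem QuasiAbs.nm_unimodular (φ : QuasiAbs R) {a b u w : R} (h : u * a + w * b = 1) :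
    1 ≤ bd ({u} + {w} : Multiset R) φ * φ.nm ![a, b] := by
  have hn := φ.nm_nonneg ![a, b]
  have ha := φ.le_nm ![a, b] 0
  have hb := φ.le_nm ![a, b] 1
  simp only [Matrix.cons_val_zero, Matrix.cons_val_one, Matrix.cons_val_fin_one] at ha hb
  have hu : φ.C * φ u ≤ bd ({u} + {w} : Multiset R) φ := by
    refine le_trans ?_ (bd_le_left _ _ _)
    simp only [bd, Multiset.map_singleton, Multiset.prod_singleton]
    exact mul_le_mul_of_nonneg_left (le_max_right _ _) φ.C_nonneg
  have hw : φ.C * φ w ≤ bd ({u} + {w} : Multiset R) φ := by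
    refine le_trans ?_ (bd_le_right _ _ _)
    simp only [bd, Multiset.map_singleton, Multiset.prod_singleton]
    exact mul_le_mul_of_nonneg_left (le_max_right _ _) φ.C_nonneg
  calc (1 : ℝ) = φ (u * a + w * b) := by rw [h, QuasiAbs.map_one]
    _ ≤ φ.C * max (φ (u * a)) (φ (w * b)) := φ.add_le _ _
    _ = max (φ.C * φ u * φ a) (φ.C * φ w * φ b) := by
        rw [QuasiAbs.map_mul, QuasiAbs.map_mul, mul_max_of_nonneg _ _ φ.C_nonneg, mul_assoc,
          mul_assoc]
    _ ≤ _ := max_le (mul_le_mul hu ha (φ.nonneg _) (bd_pos _ _).le)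
        (mul_le_mul hw hb (φ.nonneg _) (bd_pos _ _).le)

end Tate

/-! ### The two regions: bounded size, and close to η -/

section Local

variable {K F : Type*} [Field K] [CharZero K] [Field F] [Algebra K F]
  {η : Place K F} {r m : ℕ} {s : Fin r → η.regularRing}

/-- The estimate in the region where the size of the point is bounded. -/
theorem IsCurveFunctionField.log_nm_iterate_le_of_size_le (hF : IsCurveFunctionField K F)
    (hm : 1 ≤ m) (hs : GeneratesMultiple η m s) (P Q : η.regularRing[X])
    (hd : 2 ≤ ratDegree P Q) (hres : IsUnit (resultant P Q)) (hP : IsUnit P.leadingCoeff)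
    (hQ : IsUnit Q.leadingCoeff) {a b u w : η.regularRing} (hab : u * a + w * b = 1)
    (κ₀ : Multiset K) :
    ∃ κ : Multiset K, ∀ φ : QuasiAbs η.regularRing, φ.size s m ≤ bd κ₀ φ → ∀ j,
      |Real.log (φ.nm ((ratLift P Q)^[j] ![a, b])) / ratDegree P Q ^ j| ≤ Real.log (bd κ φ) ∧
      |Real.log (φ.size s m)| ≤ Real.log (bd κ φ) := by
  obtain ⟨κT, hT⟩ := exists_abs_log_ratLift_sub_le P Q (by omega) hres hP hQ
  -- Bounded size allows the error constants in A, here and for the starting point, to be replaced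
  -- by constants in K.
  obtain ⟨κT', hT'⟩ := hF.adm_bd_of_size_le hm hs κ₀ κT
  obtain ⟨κI, hI⟩ := hF.adm_bd_of_size_le hm hs κ₀ (({u} + {w}) + ({a} + {b}))
  obtain ⟨κ₁, h₁⟩ := hF.adm_one_le_size hm hs
  refine ⟨κT' + κI + (κ₀ + κ₁), fun φ hφ j => ⟨?_, ?_⟩⟩
  · set x : ℕ → Fin 2 → η.regularRing := fun j => (ratLift P Q)^[j] ![a, b] with hx
    have h0 : 1 ≤ bd ({u} + {w} : Multiset η.regularRing) φ * φ.nm ![a, b] := φ.nm_unimodular hab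
    have hpos0 : 0 < φ.nm ![a, b] := by
      by_contra! h
      have := mul_nonpos_of_nonneg_of_nonpos
        (bd_pos ({u} + {w} : Multiset η.regularRing) φ).le h
      linarith
    have hpos : ∀ j, 0 < φ.nm (x j) := by
      intro j
      induction j with
      | zero => exact hpos0
      | succ j ih =>
        have := (hT φ (x j) ih).1
        simpa only [hx, Function.iterate_succ_apply'] using this
    have hle0 : φ.nm ![a, b] ≤ bd ({a} + {b} : Multiset η.regularRing) φ := by
      refine φ.nm_le (bd_pos _ _).le fun i => ?_
      fin_cases i
      · exact (le_bd_singleton a φ).trans (bd_le_left _ _ _)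
      · exact (le_bd_singleton b φ).trans (bd_le_right _ _ _)
    have hstart : |Real.log (φ.nm (x 0))| ≤ Real.log (bd κI φ) := by
      have hb := hI φ hφ
      have := abs_log_sub_le (x := φ.nm ![a, b]) (y := 1) (B := bd κI φ) hpos0 one_pos (bd_pos _ _)
        (by rw [mul_one]; exact hle0.trans ((bd_le_right _ _ _).trans hb))
        (h0.trans (mul_le_mul_of_nonneg_right ((bd_le_left _ _ _).trans hb) hpos0.le))
      simpa [hx] using this
    have hstep : ∀ j, |Real.log (φ.nm (x (j + 1))) - (ratDegree P Q : ℝ) * Real.log (φ.nm (x j))| ≤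
        Real.log (bd κT' φ) := by
      intro j
      have := (hT φ (x j) (hpos j)).2
      refine le_trans ?_ (Real.log_le_log (bd_pos _ _) (hT' φ hφ))
      simpa only [hx, Function.iterate_succ_apply'] using this
    have h3 := abs_div_pow_sub_le (u := fun j => Real.log (φ.nm (x j)))
      (by exact_mod_cast hd) hstep j
    rw [log_bd_add, log_bd_add]
    have h4 := log_bd_nonneg (κ₀ + κ₁) φ
    have h5 := abs_add_le (Real.log (φ.nm (x j)) / (ratDegree P Q : ℝ) ^ j - Real.log (φ.nm (x 0)))
      (Real.log (φ.nm (x 0)))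
    rw [sub_add_cancel] at h5
    exact h5.trans (by linarith)
  · have hτ : 0 < φ.size s m := by
      by_contra! h
      have := mul_nonpos_of_nonneg_of_nonpos (bd_pos κ₁ φ).le h
      linarith [h₁ φ]
    have := abs_log_sub_le (x := φ.size s m) (y := 1) (B := bd (κ₀ + κ₁) φ) hτ one_pos (bd_pos _ _)
      (by rw [mul_one]; exact hφ.trans (bd_le_left _ _ _))
      ((h₁ φ).trans (mul_le_mul_of_nonneg_right (bd_le_right _ _ _) hτ.le))
    rw [Real.log_one, sub_zero] at this
    exact this.trans (log_bd_mono (Multiset.le_add_left _ _) φ)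

/-- The estimate in the region where the point is close to `η`. -/
theorem IsCurveFunctionField.log_nm_iterate_sub_le_of_lt_size (hF : IsCurveFunctionField K F)
    (hm : 1 ≤ m) (hs : GeneratesMultiple η m s) (P Q : η.regularRing[X])
    (hd : 2 ≤ ratDegree P Q) {n : ℕ} (hn : 1 ≤ n) {v : Fin 2 → η.regularRing[X]}
    (hv : v = (ratLift P Q)^[n] ![1, X]) (hv0 : IsNonzeroConstant K ((v 0).coeff 0))
    (hv10 : (v 1).coeff 0 = 0) (hv11 : (v 1).coeff 1 = 0) {D D₀ D₁ : ℕ}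
    (hD : ∀ i, ∀ k ≤ ratDegree P Q ^ n, η.val (((v i).coeff k : η.regularRing) : F) ≤
      WithZero.exp (D : ℤ))
    (x₀ : Fin 2 → η.regularRing) (hD₀ : η.val (x₀ 0 : F) = WithZero.exp (D₀ : ℤ))
    (hD₁ : η.val (x₀ 1 : F) ≤ WithZero.exp (D₁ : ℤ)) (hDD : D₁ + D + 1 ≤ D₀) :
    ∃ κ₀ κ : Multiset K, ∀ φ : QuasiAbs η.regularRing, bd κ₀ φ < φ.size s m → ∀ j,
      |Real.log (φ.nm ((ratLift P Q)^[n * j] x₀)) / (ratDegree P Q ^ n : ℝ) ^ j -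
        D₀ * Real.log (φ.size s m)| ≤ Real.log (bd κ φ) := by
  set δ := ratDegree P Q ^ n with hδ
  have hδ2 : 2 ≤ δ := hd.trans (Nat.le_self_pow (by omega) _)
  have hcoef : ∀ i, ∃ κ : Multiset K, ∀ φ : QuasiAbs η.regularRing, ∀ k ≤ δ,
      φ ((v i).coeff k) ≤ bd κ φ * φ.size s m ^ D := by
    intro i
    have h : ∀ k, ∃ κ : Multiset K, k ≤ δ → ∀ φ : QuasiAbs η.regularRing,
        φ ((v i).coeff k) ≤ bd κ φ * φ.size s m ^ D := by
      intro k
      by_cases hk : k ≤ δ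
      · obtain ⟨κ, hκ⟩ := hF.adm_le_size_pow hm hs _ D (hD i k hk)
        exact ⟨κ, fun _ => hκ⟩
      · exact ⟨0, fun h => absurd h hk⟩
    choose κ hκ using h
    refine ⟨∑ k ∈ Finset.range (δ + 1), κ k, fun φ k hk => (hκ k hk φ).trans ?_⟩
    refine mul_le_mul_of_nonneg_right (bd_mono ?_ φ) (pow_nonneg φ.size_nonneg _)
    exact Finset.single_le_sum (f := κ) (fun _ _ => Multiset.zero_le _)
      (Finset.mem_range.mpr (by omega))
  obtain ⟨κv0, hκv0⟩ := hcoef 0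
  obtain ⟨κv1, hκv1⟩ := hcoef 1
  obtain ⟨c, hc, hcv⟩ := hv0
  obtain ⟨κa, hκa⟩ := hF.adm_le_size_pow hm hs (x₀ 0) D₀ hD₀.le
  obtain ⟨κa', hκa'⟩ := hF.adm_size_pow_le hm hs (x₀ 0) D₀ hD₀.ge
  obtain ⟨κb, hκb⟩ := hF.adm_le_size_pow hm hs (x₀ 1) D₁ hD₁
  -- One B serves for all bounds; c and c⁻¹ both enter, so that v₀(0) = c is bounded above and
  -- below.
  set κB : Multiset K := κv0 + κv1 + ({c} + {c⁻¹}) + (κa + κa') + κb with hκB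
  -- The first multiset is the threshold of `basin_step`. In the second, B² bounds the telescoped
  -- sum and B compares φ(x₀ 0) with τ^D₀.
  refine ⟨(δ + 6) • κB, 3 • κB, fun φ hφ => ?_⟩
  rw [bd_nsmul] at hφ
  set B := bd κB φ with hB
  set τ := φ.size s m with hτ
  have hB1 : 1 ≤ B := one_le_bd _ _
  have hB0 : 0 < B := bd_pos _ _
  have hτB : ∀ k ≤ δ + 6, B ^ k < τ := fun k hk => (pow_le_pow_right₀ hB1 hk).trans_lt hφ
  have hτ1 : 1 < τ := by simpa using hτB 0 (by omega)
  have hτB1 : B < τ := by simpa using hτB 1 (by omega)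
  have hτ0 : 0 < τ := zero_lt_one.trans hτ1
  have hsub : ∀ κ : Multiset K, κ ≤ κB → bd κ φ ≤ B := fun κ hκ => bd_mono hκ φ
  have hle1 : κv0 ≤ κB := by
    rw [hκB, add_assoc, add_assoc, add_assoc]; exact Multiset.le_add_right _ _
  have hle2 : κv1 ≤ κB := by
    rw [hκB, add_comm κv0, add_assoc, add_assoc, add_assoc]; exact Multiset.le_add_right _ _
  have hle3 : ({c} + {c⁻¹} : Multiset K) ≤ κB := by
    rw [hκB, add_comm (κv0 + κv1), add_assoc, add_assoc]; exact Multiset.le_add_right _ _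
  have hle4 : κa + κa' ≤ κB := by
    rw [hκB, add_comm _ (κa + κa'), add_assoc]; exact Multiset.le_add_right _ _
  have hle5 : κa' + κb ≤ κB := by
    rw [hκB, ← add_assoc _ κa κa', add_assoc _ κa' κb]; exact Multiset.le_add_left _ _
  have hC : φ.C ≤ B := (C_le_bd_singleton c φ).trans
    (hsub _ ((Multiset.le_add_right _ _).trans hle3))
  have hβ : φ ((v 0).coeff 0) ≤ B := by
    rw [hcv]
    exact (le_bd_singleton c φ).trans (hsub _ ((Multiset.le_add_right _ _).trans hle3))
  have hβ' : 1 ≤ B * φ ((v 0).coeff 0) := by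
    have h1 := (le_bd_singleton c⁻¹ φ).trans (hsub _ ((Multiset.le_add_left _ _).trans hle3))
    have h2 : φ (algebraMap K η.regularRing c⁻¹) * φ (algebraMap K η.regularRing c) = 1 := by
      rw [← QuasiAbs.map_mul, ← map_mul, inv_mul_cancel₀ hc, map_one, QuasiAbs.map_one]
    rw [hcv, ← h2]
    exact mul_le_mul_of_nonneg_right h1 (φ.nonneg _)
  have hpolb : ∀ i, ∀ k ≤ δ, φ ((v i).coeff k) ≤ B * τ ^ D := by
    intro i k hk
    fin_cases i
    · exact (hκv0 φ k hk).trans (mul_le_mul_of_nonneg_right (hsub _ hle1) (pow_nonneg hτ0.le _))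
    · exact (hκv1 φ k hk).trans (mul_le_mul_of_nonneg_right (hsub _ hle2) (pow_nonneg hτ0.le _))
  have hD0pos : D₀ ≠ 0 := by omega
  have hstart1 : φ (x₀ 0) ≤ B * τ ^ D₀ := (hκa φ).trans (mul_le_mul_of_nonneg_right
    (hsub _ ((Multiset.le_add_right _ _).trans hle4)) (pow_nonneg hτ0.le _))
  have hstart2' : τ ^ D₀ ≤ bd κa' φ * φ (x₀ 0) := by
    have h1 := hκa' φ
    rcases le_total 1 (φ (x₀ 0)) with h | h
    · rwa [max_eq_left h] at h1
    -- This case is impossible: it would give τ ≤ τ^D₀ ≤ B < τ.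
    · rw [max_eq_right h, mul_one] at h1
      have h2 := hsub _ ((Multiset.le_add_left κa' κa).trans hle4)
      have h3 : τ ≤ τ ^ D₀ := le_self_pow₀ hτ1.le hD0pos
      linarith
  have hstart2 : τ ^ D₀ ≤ B * φ (x₀ 0) := hstart2'.trans (mul_le_mul_of_nonneg_right
    (hsub _ ((Multiset.le_add_left _ _).trans hle4)) (φ.nonneg _))
  have hpos0 : 0 < φ (x₀ 0) := by
    by_contra! h
    have h1 := mul_nonpos_of_nonneg_of_nonpos hB0.le h
    linarith [pow_pos hτ0 D₀]
  -- The gap D₁ + D + 1 ≤ D₀ between the pole orders is exactly what puts the starting point in the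
  -- basin.
  have hb0 : φ (x₀ 1) * τ ^ (D + 1) ≤ B * φ (x₀ 0) := by
    calc φ (x₀ 1) * τ ^ (D + 1) ≤ bd κb φ * τ ^ D₁ * τ ^ (D + 1) :=
          mul_le_mul_of_nonneg_right (hκb φ) (pow_nonneg hτ0.le _)
      _ = bd κb φ * τ ^ (D₁ + D + 1) := by ring
      _ ≤ bd κb φ * τ ^ D₀ :=
          mul_le_mul_of_nonneg_left (pow_le_pow_right₀ hτ1.le hDD) (bd_pos _ _).le
      _ ≤ bd κb φ * (bd κa' φ * φ (x₀ 0)) := mul_le_mul_of_nonneg_left hstart2' (bd_pos _ _).le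
      _ = bd (κa' + κb) φ * φ (x₀ 0) := by rw [bd_add]; ring
      _ ≤ B * φ (x₀ 0) := mul_le_mul_of_nonneg_right (hsub _ hle5) (φ.nonneg _)
  set x : ℕ → Fin 2 → η.regularRing := fun j => (ratLift P Q)^[n * j] x₀ with hx
  have hxs : ∀ j i, x (j + 1) i = MvPolynomial.aeval ![x j 1, x j 0] ((v i).homogenize δ) := by
    intro j i
    have : x (j + 1) = (ratLift P Q)^[n] (x j) := by
      simp only [hx]
      rw [← Function.iterate_add_apply]
      congr 1
      ring
    rw [this, ratLift_iterate_eq, ← hv]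
  have hinv : ∀ j, 0 < φ (x j 0) ∧ φ (x j 1) * τ ^ (D + 1) ≤ B * φ (x j 0) := by
    intro j
    induction j with
    | zero => exact ⟨hpos0, hb0⟩
    | succ j ih =>
      have := φ.basin_step hδ2 hφ hB1 hC (hpolb 0) (hpolb 1) hβ hβ' hv10 hv11 ih.1 ih.2
      rw [hxs, hxs]
      exact ⟨this.1, this.2.1⟩
  have hstep : ∀ j, |Real.log (φ (x (j + 1) 0)) - (δ : ℝ) * Real.log (φ (x j 0))| ≤
      Real.log (B ^ 2) := by
    intro j
    have := φ.basin_step hδ2 hφ hB1 hC (hpolb 0) (hpolb 1) hβ hβ' hv10 hv11 (hinv j).1 (hinv j).2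
    rw [hxs, ← Real.log_pow]
    exact abs_log_sub_le this.1 (pow_pos (hinv j).1 _) (by positivity) this.2.2.1 this.2.2.2
  have hnm : ∀ j, φ.nm (x j) = φ (x j 0) := by
    intro j
    rw [nm_two, max_eq_left]
    obtain ⟨-, h2⟩ := hinv j
    refine le_of_mul_le_mul_right ?_ hB0
    calc φ (x j 1) * B ≤ φ (x j 1) * τ ^ (D + 1) :=
          mul_le_mul_of_nonneg_left (hτB1.le.trans (le_self_pow₀ hτ1.le (by omega))) (φ.nonneg _)
      _ ≤ φ (x j 0) * B := by linarith
  intro j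
  have h1 := abs_div_pow_sub_le (u := fun j => Real.log (φ (x j 0))) (by exact_mod_cast hδ2) hstep j
  have h2 : |Real.log (φ (x₀ 0)) - Real.log (τ ^ D₀)| ≤ Real.log B :=
    abs_log_sub_le hpos0 (pow_pos hτ0 _) hB0 hstart1 hstart2
  rw [Real.log_pow] at h1 h2
  have h3 : x 0 = x₀ := by simp [hx]
  have h4 := hnm j
  simp only [hx] at h4
  rw [log_bd_nsmul, h4]
  simp only [h3] at h1
  rw [hδ] at h1
  push_cast at h1 ⊢
  refine (abs_sub_le _ (Real.log (φ (x₀ 0))) _).trans ?_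
  linarith

end Local

open QuasiAbs

/-! ### The local estimate for all quasi-absolute values -/

section Combine

variable {K F : Type*} [Field K] [CharZero K] [Field F] [Algebra K F]
  {η : Place K F} {r m : ℕ} {s : Fin r → η.regularRing}

theorem QuasiAbs.nm_iterate_pos {R : Type*} [CommRing R] (φ : QuasiAbs R) (P Q : R[X])
    (hd : 1 ≤ ratDegree P Q) (hres : IsUnit (resultant P Q)) (hP : IsUnit P.leadingCoeff)
    (hQ : IsUnit Q.leadingCoeff) {x : Fin 2 → R} (hx : 0 < φ.nm x) (j : ℕ) :
    0 < φ.nm ((ratLift P Q)^[j] x) := by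
  obtain ⟨κ, hκ⟩ := exists_abs_log_ratLift_sub_le P Q hd hres hP hQ
  induction j with
  | zero => exact hx
  | succ j ih =>
    rw [Function.iterate_succ_apply']
    exact (hκ φ _ ih).1

theorem QuasiAbs.nm_pos_of_unimodular {R : Type*} [CommRing R] (φ : QuasiAbs R) {a b u w : R}
    (h : u * a + w * b = 1) : 0 < φ.nm ![a, b] := by
  have h0 := φ.nm_unimodular h
  by_contra! h1
  have := mul_nonpos_of_nonneg_of_nonpos (bd_pos ({u} + {w} : Multiset R) φ).le h1
  linarith

/-- The threshold κ₀ from the region near η is the cutoff. Below it both terms are bounded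
separately; above it the orbit starts in the basin at time n₀, and division by d^n₀ only improves
the error. -/
theorem IsCurveFunctionField.log_nm_iterate_sub_le (hF : IsCurveFunctionField K F)
    (hm : 1 ≤ m) (hs : GeneratesMultiple η m s) (P Q : η.regularRing[X])
    (hd : 2 ≤ ratDegree P Q) (hres : IsUnit (resultant P Q)) (hP : IsUnit P.leadingCoeff)
    (hQ : IsUnit Q.leadingCoeff) {a b u w : η.regularRing} (hab : u * a + w * b = 1)
    {n : ℕ} (hn : 1 ≤ n) {v : Fin 2 → η.regularRing[X]}
    (hv : v = (ratLift P Q)^[n] ![1, X]) (hv0 : IsNonzeroConstant K ((v 0).coeff 0))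
    (hv10 : (v 1).coeff 0 = 0) (hv11 : (v 1).coeff 1 = 0) {D D₀ D₁ n₀ : ℕ}
    (hD : ∀ i, ∀ k ≤ ratDegree P Q ^ n, η.val (((v i).coeff k : η.regularRing) : F) ≤
      WithZero.exp (D : ℤ))
    (hD₀ : η.val (((ratLift P Q)^[n₀] ![a, b] 0 : η.regularRing) : F) = WithZero.exp (D₀ : ℤ))
    (hD₁ : η.val (((ratLift P Q)^[n₀] ![a, b] 1 : η.regularRing) : F) ≤ WithZero.exp (D₁ : ℤ))
    (hDD : D₁ + D + 1 ≤ D₀) :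
    ∃ κ : Multiset K, ∀ φ : QuasiAbs η.regularRing, ∀ j,
      |Real.log (φ.nm ((ratLift P Q)^[n * j + n₀] ![a, b])) / (ratDegree P Q : ℝ) ^ (n * j + n₀) -
        (D₀ / (ratDegree P Q : ℝ) ^ n₀) * Real.log (φ.size s m)| ≤ Real.log (bd κ φ) := by
  obtain ⟨κ₀, κ₁, h₁⟩ := hF.log_nm_iterate_sub_le_of_lt_size hm hs P Q hd hn hv hv0 hv10 hv11 hD
    ((ratLift P Q)^[n₀] ![a, b]) hD₀ hD₁ hDD
  obtain ⟨κ₂, h₂⟩ := hF.log_nm_iterate_le_of_size_le hm hs P Q hd hres hP hQ hab κ₀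
  -- The D₀ copies of κ₂ account for the size term, since D₀/d^n₀ ≤ D₀.
  refine ⟨κ₁ + (κ₂ + D₀ • κ₂), fun φ j => ?_⟩
  set d : ℝ := (ratDegree P Q : ℝ) with hdd
  have hd1 : 1 ≤ d ^ n₀ := one_le_pow₀ (by rw [hdd]; exact_mod_cast (by omega : 1 ≤ ratDegree P Q))
  have hd0 : 0 < d ^ n₀ := by linarith
  rw [log_bd_add, log_bd_add, log_bd_nsmul]
  rcases le_or_gt (φ.size s m) (bd κ₀ φ) with h | h
  · obtain ⟨h3, h4⟩ := h₂ φ h (n * j + n₀)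
    have h5 := log_bd_nonneg κ₁ φ
    refine (abs_sub _ _).trans ?_
    rw [abs_mul ((D₀ : ℝ) / d ^ n₀), abs_of_nonneg (div_nonneg (Nat.cast_nonneg D₀) hd0.le)]
    have h6 : (D₀ : ℝ) / d ^ n₀ ≤ D₀ := div_le_self (Nat.cast_nonneg _) hd1
    have h7 : (D₀ : ℝ) / d ^ n₀ * |Real.log (φ.size s m)| ≤ D₀ * Real.log (bd κ₂ φ) :=
      mul_le_mul h6 h4 (abs_nonneg _) (Nat.cast_nonneg _)
    linarith
  · have h3 := h₁ φ h j
    have h4 : 0 ≤ Real.log (bd κ₂ φ) := log_bd_nonneg κ₂ φ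
    have h5 : 0 ≤ (D₀ : ℝ) * Real.log (bd κ₂ φ) := mul_nonneg (Nat.cast_nonneg _) h4
    refine le_trans ?_ (by linarith : Real.log (bd κ₁ φ) ≤ _)
    refine le_trans ?_ h3
    rw [Function.iterate_add_apply, pow_add, pow_mul]
    set X := Real.log (φ.nm ((ratLift P Q)^[n * j] ((ratLift P Q)^[n₀] ![a, b])))
    set T := Real.log (φ.size s m)
    have e : X / ((d ^ n) ^ j * d ^ n₀) - D₀ / d ^ n₀ * T =
        (X / (d ^ n) ^ j - D₀ * T) / d ^ n₀ := by
      rw [sub_div, div_div]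
      ring
    rw [e, abs_div, abs_of_pos hd0]
    exact div_le_self (abs_nonneg _) hd1

end Combine

/-! ### Finiteness of residue fields -/

section Residue

variable {K F : Type*} [Field K] [Field F] [Algebra K F]

theorem Place.exists_mem_nonunit (p : Place K F) :
    ∃ t : p.ring, t ≠ 0 ∧ ¬ IsUnit t := by
  obtain ⟨t, ht⟩ := IsDiscreteValuationRing.exists_irreducible p.ring
  exact ⟨t, ht.ne_zero, ht.not_isUnit⟩

theorem Place.isUnit_of_isAlgebraic (p : Place K F) {t : p.ring} (ht : IsAlgebraic K (t : F))
    (h0 : t ≠ 0) : IsUnit t := by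
  have h0' : (t : F) ≠ 0 := by simpa using h0
  have hint : IsIntegral K (t : F)⁻¹ := ht.inv.isIntegral
  have hint' : IsIntegral p.ring (t : F)⁻¹ := hint.tower_top
  obtain ⟨y, hy⟩ := IsIntegrallyClosed.isIntegral_iff.mp hint'
  refine IsUnit.of_mul_eq_one y (Subtype.ext ?_)
  have hy' : (y : F) = (t : F)⁻¹ := hy
  rw [Subalgebra.coe_mul, hy', mul_inv_cancel₀ h0']
  rfl

/-- If f(t) were nonzero, its minimal polynomial over K would have nonzero constant term. Its value
at the nonunit t would then be a unit, yet f sends that value to 0. -/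
theorem AlgHom.map_nonunit_eq_zero {p : Place K F}
    (f : p.ring →ₐ[K] AlgebraicClosure K) {t : p.ring} (ht : ¬ IsUnit t) : f t = 0 := by
  by_contra hft
  have halg : IsIntegral K (f t) := Algebra.IsIntegral.isIntegral _
  have hne : (minpoly K (f t)).coeff 0 ≠ 0 := minpoly.coeff_zero_ne_zero halg hft
  have h1 : f (aeval t (minpoly K (f t))) = 0 := by
    rw [← Polynomial.aeval_algHom_apply, minpoly.aeval]
  have h2 : IsUnit (aeval t (minpoly K (f t))) := by
    have e : aeval t (minpoly K (f t)) =
        t * aeval t (divX (minpoly K (f t))) + algebraMap K p.ring ((minpoly K (f t)).coeff 0) := by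
      have := congrArg (aeval t) (X_mul_divX_add (minpoly K (f t)))
      simpa only [map_add, map_mul, aeval_X, aeval_C] using this.symm
    by_contra hnu
    have h3 : algebraMap K p.ring ((minpoly K (f t)).coeff 0) ∈ IsLocalRing.maximalIdeal p.ring := by
      rw [show algebraMap K p.ring ((minpoly K (f t)).coeff 0) =
        aeval t (minpoly K (f t)) - t * aeval t (divX (minpoly K (f t))) by rw [e]; ring]
      exact sub_mem hnu (Ideal.mul_mem_right _ _ ht)
    exact h3 ((IsUnit.mk0 _ hne).map (algebraMap K p.ring))
  exact (h2.map f).ne_zero h1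

/-- Since f(t) = 0, applying f to a relation kills all constant terms of the g_i. Dividing by t and
repeating shows that each g_i is divisible by every power of X. -/
theorem AlgHom.coeff_eq_zero_of_relation {p : Place K F} (f : p.ring →ₐ[K] AlgebraicClosure K)
    {t : p.ring} (ht0 : t ≠ 0) (ht : ¬ IsUnit t) {ι : Type*} [Fintype ι] {u : ι → p.ring}
    (hu : LinearIndependent K fun i => f (u i)) {g : ι → K[X]}
    (hg : ∑ i, aeval t (g i) * u i = 0) : g = 0 := by
  have hdvd : ∀ N : ℕ, ∀ g : ι → K[X], ∑ i, aeval t (g i) * u i = 0 → ∀ i, X ^ N ∣ g i := by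
    intro N
    induction N with
    | zero => intro g _ i; simp
    | succ N ih =>
      intro g hg i
      have h0 : ∀ i, (g i).coeff 0 = 0 := by
        have h1 := congrArg f hg
        simp only [map_sum, map_mul, map_zero, ← Polynomial.aeval_algHom_apply,
          AlgHom.map_nonunit_eq_zero f ht] at h1
        refine Fintype.linearIndependent_iff.mp hu (fun i => (g i).coeff 0) ?_
        simpa [Algebra.smul_def, aeval_def, eval₂_at_zero] using h1
      have hgX : ∀ i, g i = X * divX (g i) := by
        intro i
        conv_lhs => rw [← X_mul_divX_add (g i), h0 i, C_0, add_zero]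
      have h2 : ∑ i, aeval t (divX (g i)) * u i = 0 := by
        have h3 : t * ∑ i, aeval t (divX (g i)) * u i = 0 := by
          rw [Finset.mul_sum, ← hg]
          refine Finset.sum_congr rfl fun i _ => ?_
          conv_rhs => rw [hgX i]
          simp [mul_assoc]
        exact (mul_eq_zero.mp h3).resolve_left ht0
      rw [hgX i, pow_succ']
      exact mul_dvd_mul_left X (ih _ h2 i)
  funext i
  by_contra hne
  have h1 := hdvd ((g i).natDegree + 1) g hg i
  have h2 := natDegree_le_of_dvd h1 hne
  rw [natDegree_X_pow] at h2
  omega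

open scoped IntermediateField.algebraAdjoinAdjoin in
-- Lifts of K-independent elements of the range are independent over K[t], hence over K(t), for a
-- nonzero nonunit t. So there are at most [F : K(t)] of them.
theorem IsCurveFunctionField.finite_range (hF : IsCurveFunctionField K F) {p : Place K F}
    (f : p.ring →ₐ[K] AlgebraicClosure K) : FiniteDimensional K f.range := by
  obtain ⟨t, ht0, ht⟩ := p.exists_mem_nonunit
  have htr : Transcendental K (t : F) := fun h => ht (p.isUnit_of_isAlgebraic h ht0)
  have := hF.finite_adjoin htr
  have hrank : Module.rank K f.range ≤
      (Module.finrank (IntermediateField.adjoin K {(t : F)}) F : ℕ) := by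
    refine rank_le fun S hS => ?_
    have hpre : ∀ y : f.range, ∃ x : p.ring, f x = y := fun y => y.2
    choose pre hpre using hpre
    have hu : LinearIndependent K fun i : S => f (pre i) := by
      have := hS.map' f.range.val.toLinearMap (LinearMap.ker_eq_bot.mpr Subtype.val_injective)
      have e : (fun i : S => f (pre i)) = f.range.val.toLinearMap ∘ fun i : S => (i : f.range) :=
        funext fun i => hpre i
      rw [e]
      exact this
    have hlin : LinearIndependent (Algebra.adjoin K {(t : F)}) fun i : S => ((pre i : p.ring) : F) := by
      rw [Fintype.linearIndependent_iff]
      intro c hc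
      have hcp : ∀ i, ∃ g : K[X], aeval (t : F) g = (c i : F) := fun i =>
        (Algebra.adjoin_singleton_eq_range_aeval K (t : F)).le (c i).2
      choose g hg using hcp
      have h0 := AlgHom.coeff_eq_zero_of_relation f ht0 ht hu (g := g) (by
        apply Subtype.ext
        have e : ∀ i, ((aeval t (g i) : p.ring) : F) = c i := by
          intro i
          rw [← hg i]
          exact (Polynomial.aeval_algHom_apply p.ring.val t (g i)).symm
        simp only [AddSubmonoidClass.coe_finsetSum, Subalgebra.coe_mul, e]
        exact hc)
      intro i
      apply Subtype.ext
      rw [← hg i, h0]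
      simp
    have hlin' := (LinearIndependent.iff_fractionRing (Algebra.adjoin K {(t : F)})
      (IntermediateField.adjoin K {(t : F)})).mp hlin
    have := hlin'.fintype_card_le_finrank
    simpa using this
  exact Module.rank_lt_aleph0_iff.mp (hrank.trans_lt (Cardinal.natCast_lt_aleph0))

end Residue

/-! ### Comparison of heights from local comparisons -/

section HeightComparison

open QuasiAbs Height AdmissibleAbsValues

/-- An absolute value as a quasi-absolute value. -/
def AbsoluteValue.toQuasiAbs {L : Type*} [Field L] (v : AbsoluteValue L ℝ) : QuasiAbs L where
  toFun := v
  C := 2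
  one_le_C := one_le_two
  nonneg' := v.nonneg
  map_zero' := v.map_zero
  map_one' := v.map_one
  map_mul' := v.map_mul
  add_le' x y := (v.add_le x y).trans (by
    rw [two_mul]; exact add_le_add (le_max_left _ _) (le_max_right _ _))

/-- A nonarchimedean absolute value as a quasi-absolute value. -/
def AbsoluteValue.toQuasiAbsOfNonarchimedean {L : Type*} [Field L] (v : AbsoluteValue L ℝ)
    (hv : IsNonarchimedean v) : QuasiAbs L where
  toFun := v
  C := 1
  one_le_C := le_rfl
  nonneg' := v.nonneg
  map_zero' := v.map_zero
  map_one' := v.map_one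
  map_mul' := v.map_mul
  add_le' x y := (hv x y).trans (one_mul _).ge

theorem log_bd_toQuasiAbs_cons {L k : Type*} [Field L] [CommRing k] [Algebra k L]
    (v : AbsoluteValue L ℝ) (c : k) (κ : Multiset k) :
    Real.log (bd (c ::ₘ κ) v.toQuasiAbs) =
      Real.log 2 + Real.posLog (v (algebraMap k L c)) + Real.log (bd κ v.toQuasiAbs) := by
  have h : (0 : ℝ) < max 1 (v (algebraMap k L c)) := lt_max_of_lt_left one_pos
  have e : v.toQuasiAbs.C * max 1 (v.toQuasiAbs (algebraMap k L c)) =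
    2 * max 1 (v (algebraMap k L c)) := rfl
  rw [bd_cons, e, Real.log_mul (mul_pos two_pos h).ne' (bd_pos _ _).ne',
    Real.posLog_eq_log_max_one (v.nonneg _), Real.log_mul two_ne_zero h.ne']

theorem QuasiAbs.nm_pos_of_ne_zero {L ι : Type*} [Field L] [Finite ι] (φ : QuasiAbs L)
    {x : ι → L} (hx : x ≠ 0) : 0 < φ.nm x := by
  obtain ⟨i, hi⟩ := Function.ne_iff.mp hx
  refine lt_of_lt_of_le (lt_of_le_of_ne (φ.nonneg (x i)) fun h => ?_) (φ.le_nm x i)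
  have h1 : φ (x i) * φ (x i)⁻¹ = 1 := by
    rw [← φ.map_mul, mul_inv_cancel₀ (by simpa using hi), φ.map_one]
  rw [← h, zero_mul] at h1
  exact zero_ne_one h1

variable {L k : Type*} [Field L] [AdmissibleAbsValues L] [CommRing k] [Algebra k L]

/-- The quasi-absolute value of a nonarchimedean place. -/
def nonarchQuasiAbs (v : nonarchAbsVal (K := L)) : QuasiAbs L :=
  v.val.toQuasiAbsOfNonarchimedean (isNonarchimedean v.val v.2)

theorem log_bd_nonarchQuasiAbs_cons (v : nonarchAbsVal (K := L)) (c : k) (κ : Multiset k) :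
    Real.log (bd (c ::ₘ κ) (nonarchQuasiAbs v)) =
      Real.posLog (v.val (algebraMap k L c)) + Real.log (bd κ (nonarchQuasiAbs v)) := by
  have h : (0 : ℝ) < max 1 (v.val (algebraMap k L c)) := lt_max_of_lt_left one_pos
  have e : (nonarchQuasiAbs v).C * max 1 (nonarchQuasiAbs v (algebraMap k L c)) =
    max 1 (v.val (algebraMap k L c)) := one_mul _
  rw [bd_cons, e, Real.log_mul h.ne' (bd_pos _ _).ne',
    Real.posLog_eq_log_max_one (v.val.nonneg _)]

theorem finite_support_posLog_nonarch (x : L) :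
    (Function.support fun v : nonarchAbsVal (K := L) => Real.posLog (v.val x)).Finite := by
  rcases eq_or_ne x 0 with rfl | hx
  · simp
  refine (AdmissibleAbsValues.hasFiniteMulSupport hx).subset fun v hv => ?_
  contrapose! hv
  simp only [Function.mem_mulSupport, ne_eq, not_not] at hv
  simp [hv]

theorem finite_support_log_bd (κ : Multiset k) :
    (Function.support fun v : nonarchAbsVal (K := L) =>
      Real.log (bd κ (nonarchQuasiAbs v))).Finite := by
  induction κ using Multiset.induction_on with
  | empty => simp
  | cons c κ ih =>
    simp only [log_bd_nonarchQuasiAbs_cons]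
    exact ((finite_support_posLog_nonarch _).union ih).subset (Function.support_add _ _)

/-- Each constant contributes its own height, plus log 2 for every archimedean absolute value, where
C = 2. Over nonarchimedean ones C = 1, which keeps the sum finite. -/
theorem sum_log_bd (κ : Multiset k) :
    (archAbsVal.map fun v : AbsoluteValue L ℝ => Real.log (bd κ v.toQuasiAbs)).sum +
      ∑ᶠ v : nonarchAbsVal (K := L), Real.log (bd κ (nonarchQuasiAbs v)) =
    (κ.map fun c => totalWeight L * Real.log 2 + logHeight₁ (algebraMap k L c)).sum := by
  induction κ using Multiset.induction_on with
  | empty => simp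
  | cons c κ ih =>
    rw [Multiset.map_cons, Multiset.sum_cons, ← ih]
    simp only [log_bd_toQuasiAbs_cons, log_bd_nonarchQuasiAbs_cons, Multiset.sum_map_add]
    rw [finsum_add_distrib (finite_support_posLog_nonarch _) (finite_support_log_bd κ),
      logHeight₁_eq, Multiset.map_const', Multiset.sum_replicate, nsmul_eq_mul, totalWeight]
    ring

variable {ι ι' : Type*} [Finite ι] [Finite ι']

theorem finite_support_log_nm {x : ι → L} (hx : x ≠ 0) :
    (Function.support fun v : nonarchAbsVal (K := L) =>
      Real.log ((nonarchQuasiAbs v).nm x)).Finite := by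
  have hfin : (⋃ j : {j // x j ≠ 0}, Function.mulSupport
      fun v : nonarchAbsVal (K := L) => v.val (x j)).Finite :=
    Set.finite_iUnion fun j => AdmissibleAbsValues.hasFiniteMulSupport j.2
  refine hfin.subset fun v hv => ?_
  by_contra h
  simp only [Set.mem_iUnion, Function.mem_mulSupport, not_exists, not_not] at h
  obtain ⟨i, hi⟩ := Function.ne_iff.mp hx
  have h1 : (nonarchQuasiAbs v).nm x = 1 := by
    refine le_antisymm ((nonarchQuasiAbs v).nm_le zero_le_one fun j => ?_) ?_
    · by_cases hj : x j = 0
      · rw [hj, QuasiAbs.map_zero]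
        exact zero_le_one
      · exact (h ⟨j, hj⟩).le
    · exact (h ⟨i, hi⟩).ge.trans ((nonarchQuasiAbs v).le_nm x i)
  exact hv (by simp only [h1, Real.log_one])

theorem logHeight_eq_sum {x : ι → L} (hx : x ≠ 0) :
    logHeight x = (archAbsVal.map fun v : AbsoluteValue L ℝ => Real.log (v.toQuasiAbs.nm x)).sum +
      ∑ᶠ v : nonarchAbsVal (K := L), Real.log ((nonarchQuasiAbs v).nm x) := by
  have h1 : ∀ v : AbsoluteValue L ℝ, 0 < v.toQuasiAbs.nm x := fun v => nm_pos_of_ne_zero _ hx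
  have h2 : ∀ v : nonarchAbsVal (K := L), 0 < (nonarchQuasiAbs v).nm x :=
    fun v => nm_pos_of_ne_zero _ hx
  have e : mulHeight x = (archAbsVal.map fun v : AbsoluteValue L ℝ => v.toQuasiAbs.nm x).prod *
      ∏ᶠ v : nonarchAbsVal (K := L), (nonarchQuasiAbs v).nm x := mulHeight_eq hx
  have h0 := mulHeight_ne_zero x
  rw [e] at h0
  rw [logHeight, e, Real.log_mul (left_ne_zero_of_mul h0) (right_ne_zero_of_mul h0),
    Real.log_multiset_prod, Multiset.map_map, Real.log_finprod h2]
  · rfl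
  · intro a ha
    obtain ⟨v, -, rfl⟩ := Multiset.mem_map.mp ha
    exact (h1 v).ne'

theorem mul_logHeight_le {x : ι → L} {y : ι' → L} (hx : x ≠ 0) (hy : y ≠ 0) {α β : ℝ}
    (κ : Multiset k) (h : ∀ φ : QuasiAbs L,
      α * Real.log (φ.nm x) ≤ β * Real.log (φ.nm y) + Real.log (bd κ φ)) :
    α * logHeight x ≤ β * logHeight y +
      (κ.map fun c => totalWeight L * Real.log 2 + logHeight₁ (algebraMap k L c)).sum := by
  have hx' := finite_support_log_nm hx
  have hy' := finite_support_log_nm hy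
  have hb := finite_support_log_bd (L := L) κ
  rw [← sum_log_bd, logHeight_eq_sum hx, logHeight_eq_sum hy, mul_add, mul_add,
    mul_finsum, mul_finsum, ← Multiset.sum_map_mul_left,
    ← Multiset.sum_map_mul_left]
  have h1 := Multiset.sum_map_le_sum_map (s := archAbsVal)
    (fun v : AbsoluteValue L ℝ => α * Real.log (v.toQuasiAbs.nm x))
    (fun v : AbsoluteValue L ℝ => β * Real.log (v.toQuasiAbs.nm y) +
      Real.log (bd κ v.toQuasiAbs)) fun v _ => h _
  rw [Multiset.sum_map_add] at h1
  have hx'' : (Function.support fun v : nonarchAbsVal (K := L) =>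
      α * Real.log ((nonarchQuasiAbs v).nm x)).Finite :=
    hx'.subset (Function.support_const_smul_subset α _)
  have hy'' : (Function.support fun v : nonarchAbsVal (K := L) =>
      β * Real.log ((nonarchQuasiAbs v).nm y)).Finite :=
    hy'.subset (Function.support_const_smul_subset β _)
  have h2 : ∑ᶠ v : nonarchAbsVal (K := L), α * Real.log ((nonarchQuasiAbs v).nm x) ≤
      ∑ᶠ v : nonarchAbsVal (K := L), (β * Real.log ((nonarchQuasiAbs v).nm y) +
        Real.log (bd κ (nonarchQuasiAbs v))) :=
    finsum_le_finsum' hx'' ((hy''.union hb).subset (Function.support_add _ _)) fun v => h _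
  rw [finsum_add_distrib hy'' hb] at h2
  linarith

theorem abs_mul_logHeight_sub_le {x : ι → L} {y : ι' → L} (hx : x ≠ 0) (hy : y ≠ 0) {α β : ℝ}
    (κ : Multiset k) (h : ∀ φ : QuasiAbs L,
      |α * Real.log (φ.nm x) - β * Real.log (φ.nm y)| ≤ Real.log (bd κ φ)) :
    |α * logHeight x - β * logHeight y| ≤
      (κ.map fun c => totalWeight L * Real.log 2 + logHeight₁ (algebraMap k L c)).sum := by
  have h1 := mul_logHeight_le (α := α) (β := β) hx hy κ fun φ => by linarith [(abs_le.mp (h φ)).2]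
  have h2 := mul_logHeight_le (α := β) (β := α) hy hx κ fun φ => by linarith [(abs_le.mp (h φ)).1]
  rw [abs_le]
  constructor <;> linarith

end HeightComparison

/-! ### Heights at geometric points -/

section Points

open QuasiAbs Height

variable {K F : Type*} [Field K] [Field F] [Algebra K F] {η : Place K F}

/-- The residue field of a geometric point, inside the algebraic closure. -/
noncomputable def Place.AffinePoint.field (l : η.AffinePoint) :
    IntermediateField K (AlgebraicClosure K) :=
  l.hom.range.toIntermediateField' (Subalgebra.isField_of_algebraic _)

/-- Evaluation at a geometric point with values in the residue field. -/
noncomputable def Place.AffinePoint.evalField (l : η.AffinePoint) : η.regularRing →ₐ[K] l.field :=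
  l.eval.codRestrict l.field.toSubalgebra fun x => ⟨Subalgebra.inclusion (regularRing_le l.ne) x, rfl⟩

theorem Place.AffinePoint.coe_evalField (l : η.AffinePoint) (x : η.regularRing) :
    (l.evalField x : AlgebraicClosure K) = l.eval x := rfl

theorem Place.AffinePoint.evalField_ne_zero (l : η.AffinePoint) {ι : Type*}
    {x : ι → η.regularRing} (hx : (fun i => l.eval (x i)) ≠ 0) :
    (fun i => l.evalField (x i)) ≠ 0 :=
  fun h0 => hx (funext fun i => congrArg Subtype.val (congrFun h0 i))

theorem Place.AffinePoint.numberField [NumberField K] (hF : IsCurveFunctionField K F)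
    (l : η.AffinePoint) : NumberField l.field := by
  have : FiniteDimensional K l.field := hF.finite_range l.hom
  exact NumberField.of_module_finite K _

open Classical in
/-- The quasi-absolute value at a geometric point with values `0` and `1`. -/
noncomputable def Place.AffinePoint.trivialQuasiAbs (l : η.AffinePoint) :
    QuasiAbs η.regularRing :=
  ((AbsoluteValue.trivial : AbsoluteValue (AlgebraicClosure K) ℝ).toQuasiAbs).comp
    (l.eval : η.regularRing →+* AlgebraicClosure K)

open Classical in
-- Positivity of `nm` is proved for every φ at once. The trivial absolute value after evaluation
-- turns it into the fact that the coordinates have no common zero at the point.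
theorem Place.AffinePoint.eval_ne_zero_of_nm_pos (l : η.AffinePoint) {ι : Type*}
    {x : ι → η.regularRing}
    (h : 0 < l.trivialQuasiAbs.nm x) : (fun i => l.eval (x i)) ≠ 0 := by
  intro h0
  refine absurd (l.trivialQuasiAbs.nm_le le_rfl fun i => ?_) (not_le.mpr h)
  change (AbsoluteValue.trivial : AbsoluteValue (AlgebraicClosure K) ℝ) (l.eval (x i)) ≤ 0
  rw [congrFun h0 i, Pi.zero_apply, AbsoluteValue.map_zero]

variable [NumberField K] {ι ι' : Type*} [Finite ι] [Finite ι']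

/-- After division by the degree of the residue field over ℚ only absolute heights of constants of K
remain, so the bound does not depend on `l`. -/
theorem Place.AffinePoint.abs_mul_absLogHeight_sub_le (hF : IsCurveFunctionField K F)
    (l : η.AffinePoint) (κ : Multiset K) {x : ι → η.regularRing} {y : ι' → η.regularRing}
    (hx : (fun i => l.eval (x i)) ≠ 0) (hy : (fun i => l.eval (y i)) ≠ 0) {α β : ℝ}
    (h : ∀ φ : QuasiAbs η.regularRing,
      |α * Real.log (φ.nm x) - β * Real.log (φ.nm y)| ≤ Real.log (bd κ φ)) :
    |α * absLogHeight (fun i => l.eval (x i)) - β * absLogHeight (fun i => l.eval (y i))| ≤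
      (κ.map fun c => Real.log 2 + logHeight₁ c / Module.finrank ℚ K).sum := by
  have := l.numberField hF
  have hL : (0 : ℝ) < Module.finrank ℚ l.field := by exact_mod_cast Module.finrank_pos
  have hx' := l.evalField_ne_zero hx
  have hy' := l.evalField_ne_zero hy
  have key := abs_mul_logHeight_sub_le (L := l.field) hx' hy' (α := α) (β := β) κ fun φ => by
    have h1 := h (φ.comp (l.evalField : η.regularRing →+* l.field))
    have h2 : bd κ (φ.comp (l.evalField : η.regularRing →+* l.field)) = bd κ φ := by
      unfold bd
      congr 2
      funext c
      simp only [comp_apply, RingHom.coe_coe, AlgHom.commutes]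
      rfl
    rw [h2] at h1
    exact h1
  have ex := absLogHeight_eq l.field (fun i => l.evalField (x i))
  have ey := absLogHeight_eq l.field (fun i => l.evalField (y i))
  simp only [l.coe_evalField] at ex ey
  rw [ex, ey, mul_div_assoc', mul_div_assoc', ← sub_div, abs_div, abs_of_pos hL]
  refine (div_le_div_of_nonneg_right key hL.le).trans_eq ?_
  rw [← Multiset.sum_map_div]
  congr 2
  funext c
  rw [NumberField.totalWeight_eq_finrank, add_div, mul_div_cancel_left₀ _ hL.ne',
    logHeight₁_eq_logHeight, logHeight₁_eq_logHeight]
  congr 1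
  rw [← NumberField.logHeight_extension_div_finrank (L := K) (M := l.field)]
  congr 2
  funext i
  fin_cases i <;> simp

/-- With constants in A the bound depends on `l`, but not on x and y; this suffices for the limit at
a fixed point to exist. -/
theorem Place.AffinePoint.exists_abs_mul_absLogHeight_sub_le (hF : IsCurveFunctionField K F)
    (l : η.AffinePoint) (κ : Multiset η.regularRing) (α β : ℝ) :
    ∃ C : ℝ, ∀ (x : ι → η.regularRing) (y : ι' → η.regularRing),
    (fun i => l.eval (x i)) ≠ 0 → (fun i => l.eval (y i)) ≠ 0 →
    (∀ φ : QuasiAbs η.regularRing, 0 < φ.nm y →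
      |α * Real.log (φ.nm x) - β * Real.log (φ.nm y)| ≤ Real.log (bd κ φ)) →
    |α * absLogHeight (fun i => l.eval (x i)) - β * absLogHeight (fun i => l.eval (y i))| ≤ C := by
  have := l.numberField hF
  have hL : (0 : ℝ) < Module.finrank ℚ l.field := by exact_mod_cast Module.finrank_pos
  let _ : Algebra η.regularRing l.field := l.evalField.toRingHom.toAlgebra
  refine ⟨(κ.map fun c => totalWeight l.field * Real.log 2 +
    logHeight₁ (algebraMap η.regularRing l.field c)).sum / Module.finrank ℚ l.field,
    fun x y hx hy h => ?_⟩
  have hx' := l.evalField_ne_zero hx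
  have hy' := l.evalField_ne_zero hy
  have key := abs_mul_logHeight_sub_le (L := l.field) hx' hy' (α := α) (β := β) κ fun φ =>
    h (φ.comp (l.evalField : η.regularRing →+* l.field)) (φ.nm_pos_of_ne_zero hy')
  have ex := absLogHeight_eq l.field (fun i => l.evalField (x i))
  have ey := absLogHeight_eq l.field (fun i => l.evalField (y i))
  simp only [l.coe_evalField] at ex ey
  rw [ex, ey, mul_div_assoc', mul_div_assoc', ← sub_div, abs_div, abs_of_pos hL]
  exact div_le_div_of_nonneg_right key hL.le

end Points

/-! ### The canonical height over the function field -/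

section FunctionField

open QuasiAbs

variable {K F : Type*} [Field K] [Field F] [Algebra K F] {η : Place K F}

theorem Place.bd_quasiAbs_of_ne (p : Place K F) (hp : p ≠ η) (κ : Multiset η.regularRing) :
    bd κ (p.quasiAbs.comp (algebraMap η.regularRing F)) = 1 := by
  unfold bd
  rw [Multiset.prod_eq_one]
  intro x hx
  obtain ⟨c, -, rfl⟩ := Multiset.mem_map.mp hx
  have h1 : (p.quasiAbs.comp (algebraMap η.regularRing F)).C = 1 := rfl
  rw [h1, one_mul, comp_apply]
  refine max_eq_left ?_
  change p.quasiAbs (c : F) ≤ 1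
  by_cases hc : (c : F) = 0
  · rw [hc, QuasiAbs.map_zero]
    exact zero_le_one
  · rw [p.quasiAbs_apply hc, ← Real.exp_zero, Real.exp_le_exp, ← Int.cast_zero, Int.cast_le,
      ← WithZero.log_one, WithZero.log_le_log ((Valuation.ne_zero_iff _).mpr hc) one_ne_zero]
    exact η.val_regular_le p hp c

/-- Good reduction away from η: at such p every error term with constants in A vanishes, so both the
unimodular start and each iteration step preserve norm exactly 1. -/
theorem Place.nm_iterate_eq_one_of_ne (p : Place K F) (hp : p ≠ η) (P Q : η.regularRing[X])
    (hd : 1 ≤ ratDegree P Q) (hres : IsUnit (resultant P Q)) (hP : IsUnit P.leadingCoeff)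
    (hQ : IsUnit Q.leadingCoeff) {a b u w : η.regularRing} (hab : u * a + w * b = 1) (j : ℕ) :
    (p.quasiAbs.comp (algebraMap η.regularRing F)).nm ((ratLift P Q)^[j] ![a, b]) = 1 := by
  set φ := p.quasiAbs.comp (algebraMap η.regularRing F) with hφ
  obtain ⟨κ, hκ⟩ := exists_abs_log_ratLift_sub_le P Q hd hres hP hQ
  induction j with
  | zero =>
    refine le_antisymm (φ.nm_le zero_le_one fun i => ?_) ?_
    · have := le_bd_singleton (![a, b] i) φ
      rwa [Place.bd_quasiAbs_of_ne p hp] at this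
    · have := φ.nm_unimodular hab
      rwa [Place.bd_quasiAbs_of_ne p hp, one_mul] at this
  | succ j ih =>
    have h := hκ φ ((ratLift P Q)^[j] ![a, b]) (by rw [ih]; exact one_pos)
    rw [ih, Real.log_one, mul_zero, sub_zero, Place.bd_quasiAbs_of_ne p hp, Real.log_one] at h
    rw [Function.iterate_succ_apply']
    exact Real.eq_one_of_pos_of_log_eq_zero h.1 (abs_nonpos_iff.mp h.2)

theorem functionFieldHeight_iterate (hη : η.degree = 1) (P Q : η.regularRing[X])
    (hd : 1 ≤ ratDegree P Q) (hres : IsUnit (resultant P Q)) (hP : IsUnit P.leadingCoeff)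
    (hQ : IsUnit Q.leadingCoeff) {a b u w : η.regularRing} (hab : u * a + w * b = 1) (j : ℕ) :
    functionFieldHeight K (fun i => (((ratLift P Q)^[j] ![a, b] i : η.regularRing) : F)) =
      Real.log ((η.quasiAbs.comp (algebraMap η.regularRing F)).nm
        ((ratLift P Q)^[j] ![a, b])) := by
  set x := (ratLift P Q)^[j] ![a, b] with hx
  have hne : ∃ i, ((x i : η.regularRing) : F) ≠ 0 := by
    have h := nm_iterate_pos (η.quasiAbs.comp (algebraMap η.regularRing F)) P Q hd hres hP hQ
      (nm_pos_of_unimodular _ hab) j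
    by_contra! h0
    refine absurd (nm_le _ le_rfl fun i => ?_) (not_le.mpr h)
    change η.quasiAbs (x i : F) ≤ 0
    rw [h0, QuasiAbs.map_zero]
  unfold functionFieldHeight
  rw [finsum_eq_single _ η]
  · rw [hη, Nat.cast_one, one_mul, ← η.log_nm_quasiAbs hne]
    rfl
  · intro p hp
    have h := Place.nm_iterate_eq_one_of_ne p hp P Q hd hres hP hQ hab j
    rw [← p.log_nm_quasiAbs hne]
    have e : p.quasiAbs.nm (fun i => ((x i : η.regularRing) : F)) =
      (p.quasiAbs.comp (algebraMap η.regularRing F)).nm x := rfl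
    rw [e, hx, h, Real.log_one, mul_zero]

/-- The exponent 1/m in `size` is chosen for this: the sections have maximal pole order m at η. -/
theorem GeneratesMultiple.log_size_quasiAbs {r m : ℕ} {s : Fin r → η.regularRing} (hm : 1 ≤ m)
    (hs : GeneratesMultiple η m s) :
    Real.log ((η.quasiAbs.comp (algebraMap η.regularRing F)).size s m) = 1 := by
  have := hs.nonempty
  have hne : ∃ i, ((s i : η.regularRing) : F) ≠ 0 := by
    by_contra! h0
    have h := hs.2
    simp only [h0, map_zero] at h
    rw [Finset.sup_const Finset.univ_nonempty] at h
    exact WithZero.exp_ne_zero h.symm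
  have h1 := congrArg Real.log
    ((η.quasiAbs.comp (algebraMap η.regularRing F)).size_pow (s := s) hm)
  have e : (η.quasiAbs.comp (algebraMap η.regularRing F)).nm s =
    η.quasiAbs.nm (fun i => ((s i : η.regularRing) : F)) := rfl
  rw [Real.log_pow, e, η.log_nm_quasiAbs hne, hs.2, WithZero.log_exp, Int.cast_natCast] at h1
  have hm0 : (m : ℝ) ≠ 0 := by exact_mod_cast (by omega : m ≠ 0)
  exact mul_left_cancel₀ hm0 (h1.trans (mul_one _).symm)

end FunctionField

/-! ### The variation of the canonical height -/

section Variation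

open QuasiAbs

theorem IsNonzeroConstant.isUnit {K R : Type*} [Field K] [CommRing R] [Algebra K R] {x : R}
    (h : IsNonzeroConstant K x) : IsUnit x := by
  obtain ⟨t, ht, rfl⟩ := h
  exact (IsUnit.mk0 t ht).map (algebraMap K R)

theorem ratDegree_map {R S : Type*} [CommRing R] [CommRing S] [Nontrivial S] (f : R →+* S)
    {p q : R[X]} (hp : IsUnit p.leadingCoeff) (hq : IsUnit q.leadingCoeff) :
    ratDegree (p.map f) (q.map f) = ratDegree p q := by
  rw [ratDegree, ratDegree, natDegree_map_eq_of_isUnit_leadingCoeff f hp,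
    natDegree_map_eq_of_isUnit_leadingCoeff f hq]

variable {K F : Type*} [Field K] [Field F] [Algebra K F] {η : Place K F}

theorem Place.val_le_one_of_quasiAbs_le_one (p : Place K F) {x : F} (h : p.quasiAbs x ≤ 1) :
    p.val x ≤ 1 := by
  rcases eq_or_ne x 0 with rfl | hx
  · simp
  rwa [p.quasiAbs_apply hx, ← Real.exp_zero, Real.exp_le_exp, ← Int.cast_zero, Int.cast_le,
    ← WithZero.log_one, WithZero.log_le_log ((Valuation.ne_zero_iff _).mpr hx) one_ne_zero] at h

/-- A superattracting periodic point at infinity over the function field is already visible over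
the ring of regular functions. -/
theorem SuperattractingAtInfinity.exists_iterate {P Q : η.regularRing[X]}
    (hP : IsUnit P.leadingCoeff) (hQ : IsUnit Q.leadingCoeff)
    (h : SuperattractingAtInfinity (P.map (algebraMap η.regularRing F))
      (Q.map (algebraMap η.regularRing F))) :
    ∃ n : ℕ, 1 ≤ n ∧ ((ratLift P Q)^[n] ![1, X] 0 : η.regularRing[X]).coeff 0 ≠ 0 ∧
      ((ratLift P Q)^[n] ![1, X] 1 : η.regularRing[X]).coeff 0 = 0 ∧
      ((ratLift P Q)^[n] ![1, X] 1 : η.regularRing[X]).coeff 1 = 0 := by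
  obtain ⟨n, hn, h⟩ := h
  have hinj : Function.Injective (algebraMap η.regularRing F) := Subtype.val_injective
  have e := ratLift_iterate_map (algebraMap η.regularRing F)
    (mapRingHom (algebraMap η.regularRing F)) (by simp) P Q (ratDegree_map _ hP hQ) n
    (![1, X] : Fin 2 → η.regularRing[X])
  have e1 : (fun i => mapRingHom (algebraMap η.regularRing F)
      ((![1, X] : Fin 2 → η.regularRing[X]) i)) = ![1, X] := by
    funext i
    fin_cases i <;> simp
  rw [e1] at e
  rw [e] at h
  set v := (ratLift P Q)^[n] (![1, X] : Fin 2 → η.regularRing[X])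
  simp only [coe_mapRingHom, eval_sub, eval_mul, ← coeff_zero_eq_eval_zero, coeff_derivative,
    coeff_map, zero_add, Nat.cast_zero, mul_one] at h
  obtain ⟨h0, h1, h2⟩ := h
  -- As v₁(0) = 0, the derivative condition reduces to v₁'(0)·v₀(0) = 0.
  rw [h1, zero_mul, sub_zero] at h2
  refine ⟨n, hn, fun h3 => h0 (by rw [h3, map_zero]), hinj (by rw [h1, map_zero]), ?_⟩
  exact hinj (by rw [(mul_eq_zero.mp h2).resolve_right h0, map_zero])

/-- Setting w = 0 shows that the iterate of the unimodular point (1, 0) is (β, 0). Its norm is 1 at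
every p ≠ η, so β is a unit of A, and units of A are constants. -/
theorem IsCurveFunctionField.isNonzeroConstant_coeff [CharZero K] (hF : IsCurveFunctionField K F)
    (P Q : η.regularRing[X]) (hd : 1 ≤ ratDegree P Q) (hres : IsUnit (resultant P Q))
    (hP : IsUnit P.leadingCoeff) (hQ : IsUnit Q.leadingCoeff) {n : ℕ}
    (h0 : ((ratLift P Q)^[n] ![1, X] 0 : η.regularRing[X]).coeff 0 ≠ 0)
    (h1 : ((ratLift P Q)^[n] ![1, X] 1 : η.regularRing[X]).coeff 0 = 0) :
    IsNonzeroConstant K (((ratLift P Q)^[n] ![1, X] 0 : η.regularRing[X]).coeff 0) := by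
  have e := ratLift_iterate_map (RingHom.id η.regularRing) (evalRingHom 0) (by simp) P Q
    (by simp) n (![1, X] : Fin 2 → η.regularRing[X])
  have e1 : (fun i => evalRingHom 0 ((![1, X] : Fin 2 → η.regularRing[X]) i)) = ![1, 0] := by
    funext i
    fin_cases i <;> simp
  rw [e1, Polynomial.map_id, Polynomial.map_id] at e
  set v := (ratLift P Q)^[n] (![1, X] : Fin 2 → η.regularRing[X])
  simp only [coe_evalRingHom, ← coeff_zero_eq_eval_zero] at e
  set β := (v 0).coeff 0 with hβ
  have hβ0 : (β : F) ≠ 0 := by simpa using h0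
  have hmem : (β : F)⁻¹ ∈ η.regularRing := by
    rw [η.mem_regularRing_iff]
    intro p hp
    have h := Place.nm_iterate_eq_one_of_ne p hp P Q hd hres hP hQ
      (a := 1) (b := 0) (u := 1) (w := 0) (by simp) n
    rw [e, nm_two, h1, QuasiAbs.map_zero, max_eq_left (QuasiAbs.nonneg _ _)] at h
    have h' : p.quasiAbs (β : F) = 1 := h
    refine p.val_le_one_of_quasiAbs_le_one ?_
    have h2 : p.quasiAbs (β : F) * p.quasiAbs (β : F)⁻¹ = 1 := by
      rw [← QuasiAbs.map_mul, mul_inv_cancel₀ hβ0, QuasiAbs.map_one]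
    rw [h', one_mul] at h2
    exact h2.le
  refine hF.isNonzeroConstant_of_isUnit η (IsUnit.of_mul_eq_one ⟨(β : F)⁻¹, hmem⟩ ?_)
  exact Subtype.ext (mul_inv_cancel₀ hβ0)

theorem IsCurveFunctionField.exists_val_eq_exp [CharZero K] (hF : IsCurveFunctionField K F)
    (y : η.regularRing) (hy : y ≠ 0) : ∃ D : ℕ, η.val (y : F) = WithZero.exp (D : ℤ) := by
  have h1 := hF.one_le_val η hy
  have h0 : η.val (y : F) ≠ 0 := (zero_lt_one.trans_le h1).ne'
  have h2 : 0 ≤ WithZero.log (η.val (y : F)) := by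
    rw [← WithZero.log_one]
    exact (WithZero.log_le_log one_ne_zero h0).mpr h1
  exact ⟨_, by rw [Int.toNat_of_nonneg h2, WithZero.exp_log h0]⟩

theorem QuasiAbs.exists_tendsto_log_nm_div_pow {R : Type*} [CommRing R] (φ : QuasiAbs R)
    (P Q : R[X]) (hd : 2 ≤ ratDegree P Q) (hres : IsUnit (resultant P Q))
    (hP : IsUnit P.leadingCoeff) (hQ : IsUnit Q.leadingCoeff) {x : Fin 2 → R} (hx : 0 < φ.nm x) :
    ∃ H : ℝ, Tendsto (fun j => Real.log (φ.nm ((ratLift P Q)^[j] x)) / (ratDegree P Q : ℝ) ^ j)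
      atTop (𝓝 H) := by
  have hd1 : 1 ≤ ratDegree P Q := by omega
  obtain ⟨κ, hκ⟩ := exists_abs_log_ratLift_sub_le P Q hd1 hres hP hQ
  refine exists_tendsto_div_pow (E := Real.log (bd κ φ)) (by exact_mod_cast hd) fun j => ?_
  rw [Function.iterate_succ_apply']
  exact (hκ _ _ (φ.nm_iterate_pos P Q hd1 hres hP hQ hx j)).2

theorem Place.AffinePoint.exists_tendsto_absLogHeight_div_pow [NumberField K]
    (hF : IsCurveFunctionField K F) (l : η.AffinePoint) (P Q : η.regularRing[X])
    (hd : 2 ≤ ratDegree P Q) (hres : IsUnit (resultant P Q)) (hP : IsUnit P.leadingCoeff)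
    (hQ : IsUnit Q.leadingCoeff) {x : Fin 2 → η.regularRing}
    (hx : 0 < l.trivialQuasiAbs.nm x) :
    ∃ H : ℝ, Tendsto (fun j => absLogHeight (fun i => l.eval ((ratLift P Q)^[j] x i)) /
      (ratDegree P Q : ℝ) ^ j) atTop (𝓝 H) := by
  have hd1 : 1 ≤ ratDegree P Q := by omega
  obtain ⟨κ, hκ⟩ := exists_abs_log_ratLift_sub_le P Q hd1 hres hP hQ
  obtain ⟨C, hC⟩ := l.exists_abs_mul_absLogHeight_sub_le (ι := Fin 2) (ι' := Fin 2) hF κ 1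
    (ratDegree P Q)
  have hne : ∀ j, (fun i => l.eval ((ratLift P Q)^[j] x i)) ≠ 0 := fun j =>
    l.eval_ne_zero_of_nm_pos (nm_iterate_pos _ P Q hd1 hres hP hQ hx j)
  refine exists_tendsto_div_pow (E := C) (by exact_mod_cast hd) fun j => ?_
  have := hC ((ratLift P Q)^[j + 1] x) ((ratLift P Q)^[j] x) (hne _) (hne _) fun φ h => by
    rw [one_mul, Function.iterate_succ_apply']
    exact (hκ φ _ h).2
  rwa [one_mul] at this

theorem ratLift_iterate_map_pair {R S : Type*} [CommRing R] [CommRing S] [Nontrivial S]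
    (f : R →+* S) {P Q : R[X]} (hP : IsUnit P.leadingCoeff) (hQ : IsUnit Q.leadingCoeff)
    (a b : R) (j : ℕ) :
    (ratLift (P.map f) (Q.map f))^[j] ![f a, f b] = fun i => f ((ratLift P Q)^[j] ![a, b] i) := by
  rw [← ratLift_iterate_map f f (fun _ => rfl) P Q (ratDegree_map f hP hQ) j]
  congr 1
  funext i
  fin_cases i <;> rfl

theorem exists_coeff_val_le (v : Fin 2 → η.regularRing[X]) (δ : ℕ) :
    ∃ D : ℕ, ∀ i, ∀ k ≤ δ, η.val (((v i).coeff k : η.regularRing) : F) ≤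
      WithZero.exp (D : ℤ) := by
  choose f hf using fun (i : Fin 2) (k : ℕ) => exists_val_le_exp
    (η.val (((v i).coeff k : η.regularRing) : F))
  refine ⟨Finset.univ.sup fun i => (Finset.range (δ + 1)).sup (f i),
    fun i k hk => (hf i k).trans (WithZero.exp_le_exp.mpr ?_)⟩
  exact_mod_cast (Finset.le_sup (f := f i) (Finset.mem_range.mpr (Nat.lt_succ_of_le hk))).trans
    (Finset.le_sup (f := fun i => (Finset.range (δ + 1)).sup (f i)) (Finset.mem_univ i))

theorem IsCurveFunctionField.exists_exp_of_lt_deg [CharZero K] (hF : IsCurveFunctionField K F)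
    {x : Fin 2 → η.regularRing} {D : ℕ} (h : (D : ℤ) < η.deg ((x 0 : F) / x 1)) :
    ∃ D₀ D₁ : ℕ, η.val (x 0 : F) = WithZero.exp (D₀ : ℤ) ∧
      η.val (x 1 : F) ≤ WithZero.exp (D₁ : ℤ) ∧ D₁ + D + 1 ≤ D₀ := by
  unfold Place.deg at h
  -- Since `deg` is 0 at 0 and division by 0 gives 0, a degree exceeding D ≥ 0 excludes the points 0
  -- and ∞.
  have h0 : x 0 ≠ 0 := by
    intro h0
    simp only [h0, ZeroMemClass.coe_zero, zero_div, map_zero, WithZero.log_zero] at h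
    omega
  have h1 : x 1 ≠ 0 := by
    intro h1
    simp only [h1, ZeroMemClass.coe_zero, div_zero, map_zero, WithZero.log_zero] at h
    omega
  obtain ⟨D₀, hD₀⟩ := hF.exists_val_eq_exp _ h0
  obtain ⟨D₁, hD₁⟩ := hF.exists_val_eq_exp _ h1
  rw [map_div₀, hD₀, hD₁, ← WithZero.exp_sub, WithZero.log_exp] at h
  exact ⟨D₀, D₁, hD₀, hD₁.le, by omega⟩

theorem IsCurveFunctionField.nm_sections_pos [CharZero K] (hF : IsCurveFunctionField K F)
    {r m : ℕ} {s : Fin r → η.regularRing} (hm : 1 ≤ m) (hs : GeneratesMultiple η m s)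
    (φ : QuasiAbs η.regularRing) : 0 < φ.nm s := by
  obtain ⟨κ, hκ⟩ := hF.adm_one_le_size hm hs
  rw [← φ.size_pow hm]
  refine pow_pos (lt_of_le_of_ne φ.size_nonneg fun h0 => ?_) m
  have := hκ φ
  rw [← h0, mul_zero] at this
  exact absurd this (by norm_num)

end Variation

theorem mainTheorem5 {K F : Type*} [Field K] [NumberField K] [Field F] [Algebra K F]
    (_hF : IsCurveFunctionField K F) (η : Place K F) (_hη : η.degree = 1)
    (P Q : η.regularRing[X]) (_hd : 2 ≤ ratDegree P Q)
    (_hres : IsNonzeroConstant K (resultant P Q))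
    (_hP : IsNonzeroConstant K P.leadingCoeff) (_hQ : IsNonzeroConstant K Q.leadingCoeff)
    (_hinf : SuperattractingAtInfinity
      (P.map (algebraMap η.regularRing F)) (Q.map (algebraMap η.regularRing F)))
    (a b : η.regularRing) (_hab : Ideal.span {a, b} = ⊤)
    (_hc : ¬ BddAbove (Set.range fun n : ℕ =>
      let x : Fin 2 → F := (ratLift (P.map (algebraMap η.regularRing F))
        (Q.map (algebraMap η.regularRing F)))^[n] ![(a : F), (b : F)]
      η.deg (x 0 / x 1))) :
    ∃ (hfc : ℝ) (hlam : η.AffinePoint → ℝ),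
      HasCanonicalHeight (functionFieldHeight K)
        (P.map (algebraMap η.regularRing F)) (Q.map (algebraMap η.regularRing F))
        ![(a : F), (b : F)] hfc ∧
      (∀ l : η.AffinePoint, HasCanonicalHeight absLogHeight
        (P.map (l.eval : η.regularRing →+* AlgebraicClosure K))
        (Q.map (l.eval : η.regularRing →+* AlgebraicClosure K))
        ![l.eval a, l.eval b] (hlam l)) ∧
      ∀ h : η.AffinePoint → ℝ, IsWeilHeight η h →
        ∃ C : ℝ, ∀ l : η.AffinePoint, |hlam l - hfc * h l| ≤ C := by
  have hres := _hres.isUnit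
  have hP := _hP.isUnit
  have hQ := _hQ.isUnit
  have hd1 : 1 ≤ ratDegree P Q := by omega
  obtain ⟨u, w, hab⟩ := Ideal.mem_span_pair.mp ((Ideal.eq_top_iff_one _).mp _hab)
  have hpos : ∀ (φ : QuasiAbs η.regularRing) j, 0 < φ.nm ((ratLift P Q)^[j] ![a, b]) := fun φ j =>
    φ.nm_iterate_pos P Q hd1 hres hP hQ (φ.nm_pos_of_unimodular hab) j
  have hxF : ∀ j, (ratLift (P.map (algebraMap η.regularRing F))
      (Q.map (algebraMap η.regularRing F)))^[j] ![(a : F), (b : F)] =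
      fun i => (((ratLift P Q)^[j] ![a, b] i : η.regularRing) : F) :=
    ratLift_iterate_map_pair (algebraMap η.regularRing F) hP hQ a b
  obtain ⟨hfc, hfun⟩ := (η.quasiAbs.comp (algebraMap η.regularRing F)).exists_tendsto_log_nm_div_pow
    P Q _hd hres hP hQ
    (x := ![a, b]) (hpos _ 0)
  choose hlam hgeo using fun l : η.AffinePoint =>
    l.exists_tendsto_absLogHeight_div_pow _hF P Q _hd hres hP hQ
    (x := ![a, b]) (hpos _ 0)
  refine ⟨hfc, hlam, ?_, fun l => ?_, ?_⟩
  · unfold HasCanonicalHeight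
    rw [ratDegree_map _ hP hQ]
    refine hfun.congr fun j => ?_
    rw [hxF, functionFieldHeight_iterate _hη P Q hd1 hres hP hQ hab]
  · unfold HasCanonicalHeight
    rw [ratDegree_map _ hP hQ]
    refine (hgeo l).congr fun j => ?_
    rw [← RingHom.coe_coe, ratLift_iterate_map_pair _ hP hQ]
  obtain ⟨n, hn, hv0, hv10, hv11⟩ := _hinf.exists_iterate hP hQ
  have hβ := _hF.isNonzeroConstant_coeff P Q hd1 hres hP hQ hv0 hv10
  obtain ⟨D, hD⟩ := exists_coeff_val_le
    (((ratLift P Q)^[n] ![1, X] : Fin 2 → η.regularRing[X])) (ratDegree P Q ^ n)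
  -- Unbounded degrees supply a time n₀ at which the pole order of the orbit at η exceeds that of
  -- all relevant coefficients of the iterate.
  obtain ⟨_, ⟨n₀, rfl⟩, hlt⟩ := not_bddAbove_iff.mp _hc (D : ℤ)
  simp only [hxF] at hlt
  obtain ⟨D₀, D₁, hD₀, hD₁, hDD⟩ := _hF.exists_exp_of_lt_deg hlt
  rintro h ⟨m, r, s, hm, hs, C, hC⟩
  obtain ⟨κ, hκ⟩ := _hF.log_nm_iterate_sub_le hm hs P Q _hd hres hP hQ hab hn rfl hβ hv10 hv11 hD
    hD₀ hD₁ hDD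
  -- The limits exist along the whole sequence, so they may be evaluated along the times nj + n₀ of
  -- the local estimate.
  have hsub : Tendsto (fun j => n * j + n₀) atTop atTop :=
    tendsto_atTop_mono (fun j => Nat.le_add_right_of_le (Nat.le_mul_of_pos_left j hn)) tendsto_id
  -- The local estimate at η itself: the error is 0 and the logarithm of the size is 1.
  have hfc' : hfc = D₀ / (ratDegree P Q : ℝ) ^ n₀ := by
    have h1 : |hfc - D₀ / (ratDegree P Q : ℝ) ^ n₀| ≤ 0 := by
      refine le_of_tendsto ((hfun.comp hsub).sub_const _).abs (Eventually.of_forall fun j => ?_)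
      have := hκ (η.quasiAbs.comp (algebraMap η.regularRing F)) j
      rwa [hs.log_size_quasiAbs hm, η.bd_quasiAbs, Real.log_one, mul_one] at this
    exact sub_eq_zero.mp (abs_nonpos_iff.mp h1)
  have hm0 : (m : ℝ) ≠ 0 := by exact_mod_cast (by omega : m ≠ 0)
  refine ⟨(κ.map fun c => Real.log 2 + Height.logHeight₁ c / Module.finrank ℚ K).sum + |hfc| * C,
    fun l => ?_⟩
  have h1 : |hlam l - hfc / m * absLogHeight (fun i => l.eval (s i))| ≤
      (κ.map fun c => Real.log 2 + Height.logHeight₁ c / Module.finrank ℚ K).sum := by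
    refine le_of_tendsto (((hgeo l).comp hsub).sub_const _).abs (Eventually.of_forall fun j => ?_)
    have := l.abs_mul_absLogHeight_sub_le _hF κ (x := (ratLift P Q)^[n * j + n₀] ![a, b]) (y := s)
      (α := 1 / (ratDegree P Q : ℝ) ^ (n * j + n₀)) (β := hfc / m)
      (l.eval_ne_zero_of_nm_pos (hpos _ _))
      (l.eval_ne_zero_of_nm_pos (_hF.nm_sections_pos hm hs _)) fun φ => by
        -- The factor 1/m in β cancels the m in log `nm s` = m·log `size`, and what remains is the
        -- local estimate.
        rw [← φ.size_pow (s := s) hm, Real.log_pow, ← mul_assoc, div_mul_cancel₀ _ hm0, hfc',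
          one_div_mul_eq_div]
        exact hκ φ j
    rwa [one_div_mul_eq_div] at this
  have h2 : |hfc / m * absLogHeight (fun i => l.eval (s i)) - hfc * h l| ≤ |hfc| * C := by
    rw [div_mul_eq_mul_div, mul_div_assoc, ← mul_sub, abs_mul, abs_sub_comm]
    exact mul_le_mul_of_nonneg_left (hC l) (abs_nonneg _)
  exact (abs_sub_le _ _ _).trans (add_le_add h1 h2)
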